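/- Let $k$ be a field and let $A$ be a finite-dimensional (associative, unital) $k$-algebra of finite global dimension $d\in\mathbb{Z}_{\ge 0}$. Let $\mathrm{Perf}(A)$ be the thick triangulated subcategory, generated by $A$, of the derived category of right $A$-modules. For objects $X,Y$ of a triangulated category write $\mathrm{Hom}^i(X,Y)=\mathrm{Hom}(X,Y[i])$ and $e_-(X,Y)=\inf\{i\in\mathbb{Z}\mid \mathrm{Hom}^i(X,Y)\neq 0\}$ (with $\inf\emptyset=+\infty$). A Serre functor on a $k$-linear category $T$ is an endofunctor $S$ of $T$ with $k$-linear isomorphisms $\mathrm{Hom}(X,Y)\cong \mathrm{Hom}(Y,S(X))^*$, natural in $X,Y\in T$, where $(-)^*$ is the $k$-dual. A (classical) generator of a triangulated category $T$ is an object $G$ such that every object of $T$ is obtained from $G$ by shifts, finite direct sums, cones and direct summands. Then $\mathrm{Perf}(A)$ is Ext-finite over $k$ (that is, $\sum_i\dim_k \mathrm{Hom}^i(X,Y)<\infty$ for all $X,Y$), has a generator and has a Serre functor, so that its upper Serre dimension is defined, and $$\mathrm{USdim}\,\mathrm{Perf}(A)\le d .$$ Explicitly, for every Serre functor $S$ of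 $\mathrm{Perf}(A)$ and all generators $G,G'$ of $\mathrm{Perf}(A)$, $$\limsup_{m\to+\infty}\frac{-e_-(G,S^m(G'))}{m}\le d .$$ -/

import Mathlib

open CategoryTheory

universe w u

noncomputable section

namespace SerreDim

section Triangulated

variable (k : Type*) [Field k] {T : Type*} [Category T] [Preadditive T] [Linear k T]
  [HasShift T ℤ]

/-- `T` is Ext-finite over `k`: for all objects `X`, `Y`, the graded space
`⨁ i, Hom(X, Y[i])` is a finite-dimensional `k`-vector space. -/
def IsExtFinite (T : Type*) [Category T] [Preadditive T] [Linear k T] [HasShift T ℤ] : Prop :=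
  ∀ X Y : T, Module.Finite k (DirectSum ℤ fun i => (X ⟶ Y⟦i⟧))

/-- `S` is a Serre functor of `T` over `k`: there are `k`-linear isomorphisms
`Hom(X, Y) ≃ Hom(Y, S X)^*`, natural in both variables. -/
def IsSerreFunctor (S : T ⥤ T) : Prop :=
  ∃ η : ∀ X Y : T, (X ⟶ Y) ≃ₗ[k] Module.Dual k (Y ⟶ S.obj X),
    (∀ (X' X Y : T) (f : X' ⟶ X) (g : X ⟶ Y) (h : Y ⟶ S.obj X'),
      η X' Y (f ≫ g) h = η X Y g (h ≫ S.map f)) ∧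
    (∀ (X Y Y' : T) (g : X ⟶ Y) (f : Y ⟶ Y') (h : Y' ⟶ S.obj X),
      η X Y' (g ≫ f) h = η X Y g (f ≫ h))

/-- `e₋(X, Y) = inf {i | Hom(X, Y[i]) ≠ 0}`, with value `+∞` if there is no such `i`. -/
def eMinus (X Y : T) : EReal :=
  sInf ((fun i : ℤ => ((i : ℝ) : EReal)) '' {i : ℤ | Nontrivial (X ⟶ Y⟦i⟧)})

/-- The number `limsup_{m → ∞} -e₋(G, Sᵐ(G')) / m`. When `S` is the Serre functor of `T` and
`G`, `G'` are classical generators of `T`, this is the upper Serre dimension of `T`. -/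
def upperSerreDim (S : T ⥤ T) (G G' : T) : EReal :=
  Filter.limsup (fun m : ℕ => -eMinus G (S.obj^[m] G') / (m : EReal)) Filter.atTop

/-- `G` is a classical generator of `T`: every object is obtained from `G` by
shifts, finite direct sums, cones and direct summands. -/
def IsGenerator {T : Type*} [Category T] [Preadditive T] [Limits.HasZeroObject T] [HasShift T ℤ]
    [∀ n : ℤ, (shiftFunctor T n).Additive] [Pretriangulated T] (G : T) : Prop :=
  (ObjectProperty.singleton G).IsClassicalTriangulatedGenerator

end Triangulated

section Algebra

variable (A : Type u) [Ring A]

/-- The (right) global dimension of `A`: the supremum of the projective dimensions of all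
right `A`-modules, i.e. of all modules over the opposite ring. -/
def globalDimension : WithBot ℕ∞ :=
  ⨆ M : ModuleCat.{u} Aᵐᵒᵖ, projectiveDimension M

variable [HasDerivedCategory.{w} (ModuleCat.{u} Aᵐᵒᵖ)]

/-- The objects of the derived category of right `A`-modules that lie in the thick triangulated
subcategory generated by the right module `A` placed in degree `0`. -/
def isPerfect : ObjectProperty (DerivedCategory (ModuleCat.{u} Aᵐᵒᵖ)) :=
  (ObjectProperty.singleton
    ((DerivedCategory.singleFunctor (ModuleCat.{u} Aᵐᵒᵖ) 0).obj
      (ModuleCat.of Aᵐᵒᵖ A))).triangEnvelope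

instance : (isPerfect A).IsTriangulated :=
  inferInstanceAs (ObjectProperty.triangEnvelope _).IsTriangulated

/-- The triangulated category `Perf(A)` of perfect complexes of right `A`-modules. -/
abbrev Perf := (isPerfect A).FullSubcategory

end Algebra

end SerreDim

end

/-! The inequality rests on one estimate: if `Y` is perfect and lives in degrees `≥ c`, then `S Y`
lives in degrees `≥ c - d` (`IsSerreFunctor.isGE_obj`). Indeed `H^i(S Y) = Hom(A[-i], S Y)`, and by
Serre duality this vanishes once `Hom(Y, A[-i])` does. Truncating `Y` into modules placed in degrees
`n ≥ c` leaves groups `Ext^(n-i)(M, A)`, which vanish for `i < c - d`. Iterating, `e₋(G, Sᵐ G')` is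
at least a constant minus `m * d`.

The longer half is the existence of a Serre functor. By Yoneda it suffices that each `Hom(X, -)^*`
on perfect objects is represented by a perfect object (`HasDual`). Here a representation is a
functional `t` on `Hom(X, S)` making `(x, h) ↦ t (x ≫ h)` a perfect pairing (`IsDualAt`). For `X =
A` the object is the `k`-dual of `A`, perfect because finitely generated modules have finite
projective dimension. `HasDual` passes to shifts and cones (`HasDual.cone`), but to retracts only
when the matching idempotent of the representing object splits. So the thick closure is not used
directly: retracts are taken among modules, where idempotents split, to reach finitely generated
projectives. Resolutions then give all finitely generated modules, and truncation
(`prop_of_homology`) all perfect complexes.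

Ext-finiteness follows by dévissage in both variables from `Hom(A, A[n])`. -/

noncomputable section

namespace SerreDim

open Limits Pretriangulated

/-! ### Functionals on morphism spaces and the pairings they induce -/

section LinearAlgebra

variable {k V W U : Type*} [Field k] [AddCommGroup V] [Module k V] [AddCommGroup W] [Module k W]

/-- A functional vanishing on the kernel of `p` factors through `p`. -/
lemma exists_dual_comp_eq (p : V →ₗ[k] W) (l : Module.Dual k V)
    (h : ∀ v, p v = 0 → l v = 0) : ∃ m : Module.Dual k W, ∀ v, m (p v) = l v := by
  have hl : l ∈ LinearMap.range p.dualMap := by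
    rw [LinearMap.range_dualMap_eq_dualAnnihilator_ker, Submodule.mem_dualAnnihilator]
    exact fun v hv => h v hv
  obtain ⟨m, rfl⟩ := hl
  exact ⟨m, fun v => rfl⟩

end LinearAlgebra

section Pairing

variable {k : Type*} [Field k] {C : Type*} [Category C] [Preadditive C] [Linear k C]

/-- The functionals on `Hom(X, Y)` for the `k`-linear structure of the category. -/
abbrev HomDual (k : Type*) [Field k] {C : Type*} [Category C] [Preadditive C] [Linear k C]
    (X Y : C) : Type _ := (X ⟶ Y) →ₗ[k] k

/-- The map `Hom(Y, S) → Hom(X, Y)^*` induced by a functional `t` on `Hom(X, S)`. -/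
def pairing {X S : C} (t : HomDual k X S) (Y : C) : (Y ⟶ S) →ₗ[k] Module.Dual k (X ⟶ Y) :=
  ((Linear.comp X Y S).compr₂ t).flip

@[simp]
lemma pairing_apply {X S : C} (t : HomDual k X S) (Y : C) (h : Y ⟶ S) (x : X ⟶ Y) :
    pairing t Y h x = t (x ≫ h) := rfl

/-- The functional `t` on `Hom(X, S)` identifies `Hom(Y, S)` with `Hom(X, Y)^*`. -/
def IsDualAt {X S : C} (t : HomDual k X S) (Y : C) : Prop :=
  Function.Bijective (pairing t Y)

lemma IsDualAt.ext {X S Y : C} {t : HomDual k X S} (ht : IsDualAt t Y) {h h' : Y ⟶ S}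
    (hh : ∀ x : X ⟶ Y, t (x ≫ h) = t (x ≫ h')) : h = h' :=
  ht.1 (LinearMap.ext hh)

lemma IsDualAt.eq_zero {X S Y : C} {t : HomDual k X S} (ht : IsDualAt t Y) {h : Y ⟶ S}
    (hh : ∀ x : X ⟶ Y, t (x ≫ h) = 0) : h = 0 :=
  ht.ext fun x => by rw [hh, comp_zero, map_zero]

lemma IsDualAt.exists_eq {X S Y : C} {t : HomDual k X S} (ht : IsDualAt t Y)
    (l : HomDual k X Y) : ∃ h : Y ⟶ S, ∀ x, t (x ≫ h) = l x := by
  obtain ⟨h, rfl⟩ := ht.2 l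
  exact ⟨h, fun x => rfl⟩

lemma isDualAt_of {X S Y : C} {t : HomDual k X S}
    (h₁ : ∀ h : Y ⟶ S, (∀ x : X ⟶ Y, t (x ≫ h) = 0) → h = 0)
    (h₂ : ∀ l : HomDual k X Y, ∃ h : Y ⟶ S, ∀ x, t (x ≫ h) = l x) : IsDualAt t Y := by
  constructor
  · rw [injective_iff_map_eq_zero]
    exact fun h hh => h₁ h fun x => LinearMap.congr_fun hh x
  · intro l
    obtain ⟨h, hh⟩ := h₂ l
    exact ⟨h, LinearMap.ext hh⟩

lemma IsDualAt.of_retract {X S Y Y' : C} {t : HomDual k X S} (ht : IsDualAt t Y')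
    (r : Retract Y Y') : IsDualAt t Y := by
  apply isDualAt_of
  · intro h hh
    have : r.r ≫ h = 0 := ht.eq_zero fun x => by simpa using hh (x ≫ r.r)
    rw [← Category.id_comp h, ← r.retract, Category.assoc, this, comp_zero]
  · intro l
    obtain ⟨h, hh⟩ := ht.exists_eq (l ∘ₗ Linear.rightComp k X r.r)
    exact ⟨r.i ≫ h, fun x => by simpa using hh (x ≫ r.i)⟩

lemma isDualAt_of_subsingleton {X S Y : C} (t : HomDual k X S) (h₁ : ∀ h : Y ⟶ S, h = 0)
    (h₂ : ∀ x : X ⟶ Y, x = 0) : IsDualAt t Y :=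
  isDualAt_of (fun h _ => h₁ h) fun l => ⟨0, fun x => by simp [h₂ x]⟩

/-- The functor `Hom(X, -)^*` on the objects satisfying `P` is represented by an object
satisfying `P`. -/
def HasDual (k : Type*) [Field k] [Linear k C] (P : ObjectProperty C) (X : C) : Prop :=
  ∃ S : C, P S ∧ ∃ t : HomDual k X S, ∀ Y, P Y → IsDualAt t Y

lemma HasDual.of_iso {P : ObjectProperty C} {X X' : C} (h : HasDual k P X) (e : X ≅ X') :
    HasDual k P X' := by
  obtain ⟨S, hS, t, ht⟩ := h
  refine ⟨S, hS, t ∘ₗ Linear.leftComp k S e.hom, fun Y hY => isDualAt_of ?_ ?_⟩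
  · exact fun h hh => (ht Y hY).eq_zero fun x => by simpa using hh (e.inv ≫ x)
  · intro l
    obtain ⟨h, hh⟩ := (ht Y hY).exists_eq (l ∘ₗ Linear.leftComp k Y e.inv)
    exact ⟨h, fun x => by simpa using hh (e.hom ≫ x)⟩

/-- Duality data for finite direct sums. -/
lemma isDualAt_sum {ι : Type*} [Fintype ι] [DecidableEq ι] {X S X' S' Y : C}
    {t : HomDual k X S}
    (ht : IsDualAt t Y) (i : ι → (X ⟶ X')) (p : ι → (X' ⟶ X)) (i' : ι → (S ⟶ S'))
    (p' : ι → (S' ⟶ S)) (hX : ∑ j, p j ≫ i j = 𝟙 X') (hS : ∑ j, p' j ≫ i' j = 𝟙 S')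
    (hip : ∀ j l, i j ≫ p l = if j = l then 𝟙 X else 0)
    (hip' : ∀ j l, i' j ≫ p' l = if j = l then 𝟙 S else 0) :
    IsDualAt (∑ j, t ∘ₗ Linear.leftComp k S (i j) ∘ₗ Linear.rightComp k X' (p' j)) Y := by
  apply isDualAt_of
  · intro h hh
    have (l : ι) : h ≫ p' l = 0 := ht.eq_zero fun x => by
      -- Testing on `p l ≫ x` kills every summand of the trace except the `l`-th.
      have := hh (p l ≫ x)
      simp only [LinearMap.sum_apply, LinearMap.comp_apply, Linear.leftComp_apply,
        Linear.rightComp_apply, Category.assoc] at this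
      rw [Finset.sum_eq_single l] at this
      · simpa [reassoc_of% (hip l l)] using this
      · intro b _ hb
        have := hip b l
        rw [if_neg hb] at this
        simp [reassoc_of% this]
      · simp
    rw [← Category.comp_id h, ← hS, Preadditive.comp_sum]
    exact Finset.sum_eq_zero fun j _ => by rw [reassoc_of% (this j), zero_comp]
  · intro l
    choose h hh using fun j => ht.exists_eq (l ∘ₗ Linear.leftComp k Y (p j))
    refine ⟨∑ j, h j ≫ i' j, fun x => ?_⟩
    have (j : ι) : (∑ l, h l ≫ i' l) ≫ p' j = h j := by
      rw [Preadditive.sum_comp, Finset.sum_eq_single j]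
      · simp [hip']
      · intro b _ hb; simp [hip', hb]
      · simp
    simp only [LinearMap.sum_apply, LinearMap.comp_apply, Linear.leftComp_apply,
        Linear.rightComp_apply, Category.assoc, this]
    have (j : ι) : t (i j ≫ x ≫ h j) = l (p j ≫ i j ≫ x) := by
      simpa using hh j (i j ≫ x)
    simp only [this]
    rw [← map_sum]
    simp only [← Category.assoc]
    rw [← Preadditive.sum_comp, hX, Category.id_comp]

/-- Representability passes to a retract `X` of `X'` if the idempotent of the representing object
which corresponds to the idempotent of `X'` splits. -/
lemma HasDual.of_retract {P : ObjectProperty C} [P.IsStableUnderRetracts] {X X' S' : C}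
    (hS' : P S') (t : HomDual k X' S') (ht : ∀ Y, P Y → IsDualAt t Y) (r : Retract X X')
    (split : ∀ e : S' ⟶ S', e ≫ e = e → ∃ (S : C) (i : S ⟶ S') (p : S' ⟶ S),
      i ≫ p = 𝟙 S ∧ p ≫ i = e) : HasDual k P X := by
  obtain ⟨e, he⟩ := (ht S' hS').exists_eq (t ∘ₗ Linear.leftComp k S' (r.r ≫ r.i))
  replace he (x : X' ⟶ S') : t (x ≫ e) = t (r.r ≫ r.i ≫ x) := by simpa using he x
  have hee : e ≫ e = e := (ht S' hS').ext fun x => by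
    rw [← Category.assoc, he, he]
    have := he (r.r ≫ r.i ≫ x)
    simp only [Category.assoc, Retract.retract_assoc] at this ⊢
    exact this
  obtain ⟨S, i, p, hip, hpi⟩ := split e hee
  refine ⟨S, P.prop_of_retract ⟨i, p, hip⟩ hS',
    t ∘ₗ Linear.leftComp k S' r.r ∘ₗ Linear.rightComp k X i, fun Y hY => isDualAt_of ?_ ?_⟩
  · intro h hh
    have : h ≫ i = 0 := (ht Y hY).eq_zero fun y => by
      have h1 : h ≫ i = (h ≫ i) ≫ e := by
        rw [← hpi]; simp [reassoc_of% hip]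
      rw [h1, ← Category.assoc, he]
      simpa using hh (r.i ≫ y)
    rw [← Category.comp_id h, ← hip, reassoc_of% this, zero_comp]
  · intro l
    obtain ⟨h, hh⟩ := (ht Y hY).exists_eq (l ∘ₗ Linear.leftComp k Y r.i)
    refine ⟨h ≫ p, fun x => ?_⟩
    have h1 := he (r.r ≫ x ≫ h)
    have h2 := hh (r.r ≫ x)
    simp only [Category.assoc, Retract.retract_assoc, LinearMap.comp_apply,
      Linear.leftComp_apply, Linear.rightComp_apply] at h1 h2 ⊢
    rw [hpi, h1, h2]

end Pairing

/-! ### From representability to a Serre functor -/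

section Functor

variable (k : Type*) [Field k] {T : Type*} [Category T] [Preadditive T] [Linear k T]

/-- A `Hom`-finite category in which all `Hom(X, -)^*` are representable has a Serre functor. -/
lemma exists_isSerreFunctor [∀ X Y : T, Module.Finite k (X ⟶ Y)]
    (h : ∀ X : T, HasDual k (⊤ : ObjectProperty T) X) : ∃ S : T ⥤ T, IsSerreFunctor k S := by
  choose S _ t ht using h
  replace ht (X Y : T) : IsDualAt (t X) Y := ht X Y trivial
  have hex {X' X : T} (f : X' ⟶ X) : ∃ g : S X' ⟶ S X, ∀ x : X ⟶ S X',
      t X (x ≫ g) = t X' (f ≫ x) :=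
    (ht X (S X')).exists_eq (t X' ∘ₗ Linear.leftComp k (S X') f)
  choose m hm using @hex
  have hm' {X' X Y : T} (f : X' ⟶ X) (g : X ⟶ Y) (h : Y ⟶ S X') :
      t X (g ≫ h ≫ m f) = t X' (f ≫ g ≫ h) := by
    rw [← Category.assoc, hm]
  let F : T ⥤ T :=
    { obj := S
      map := m
      map_id := fun X => (ht X (S X)).ext fun x => by rw [hm]; simp
      map_comp := fun {X Y Z} f g => (ht Z (S X)).ext fun x => by
        rw [hm, ← Category.assoc x, hm g, hm', Category.assoc] }
  -- The pairing identifies `Hom(Y, S X)` with `Hom(X, Y)^*`; finite dimension enters through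
  -- biduality, to turn this around.
  let η (X Y : T) : (X ⟶ Y) ≃ₗ[k] Module.Dual k (Y ⟶ S X) :=
    Module.evalEquiv k (X ⟶ Y) ≪≫ₗ
      (LinearEquiv.ofBijective (pairing (t X) Y) (ht X Y)).dualMap
  have hη (X Y : T) (g : X ⟶ Y) (h : Y ⟶ S X) : η X Y g h = t X (g ≫ h) := rfl
  refine ⟨F, η, ?_, ?_⟩
  · intro X' X Y f g h
    erw [hη, hη]
    rw [Category.assoc]
    exact (hm' f g h).symm
  · intro X Y Y' g f h
    erw [hη]
    rw [Category.assoc]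
    exact (hη ..).symm

end Functor

/-! ### Duality and representability in triangles -/

section Triangulated

variable {k : Type*} [Field k] {C : Type*} [Category C] [Preadditive C] [Linear k C]
  [HasZeroObject C] [HasShift C ℤ] [∀ n : ℤ, (shiftFunctor C n).Additive]
  [Pretriangulated C]

/-- Dévissage in the test object: two out of three for a distinguished triangle. -/
lemma isDualAt_obj₂ {X S : C} {t : HomDual k X S} (T : Triangle C) (hT : T ∈ distTriang C)
    (h₁ : IsDualAt t T.obj₁) (h₃ : IsDualAt t T.obj₃) (h₁' : IsDualAt t (T.obj₁⟦(1 : ℤ)⟧))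
    (h₃' : IsDualAt t (T.obj₃⟦(-1 : ℤ)⟧)) : IsDualAt t T.obj₂ := by
  apply isDualAt_of
  · intro h hh
    have : T.mor₁ ≫ h = 0 := h₁.eq_zero fun x => by simpa using hh (x ≫ T.mor₁)
    obtain ⟨h', rfl⟩ := T.yoneda_exact₂ hT h this
    -- The functional of `h'` vanishes on maps coming from `T.obj₂`, so it descends to `Hom(X,
    -- T.obj₁⟦1⟧)`; duality there gives a factorization of `h'` through `T.mor₃`.
    obtain ⟨l, hl⟩ := exists_dual_comp_eq (Linear.rightComp k X T.mor₃) (pairing t T.obj₃ h') (by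
      intro x hx
      obtain ⟨x, rfl⟩ := T.coyoneda_exact₃ hT x hx
      simpa using hh x)
    obtain ⟨q, hq⟩ := h₁'.exists_eq l
    have : h' = T.mor₃ ≫ q := h₃.ext fun x => by
      rw [← Category.assoc, hq]
      exact (hl x).symm
    rw [this, comp_distTriang_mor_zero₂₃_assoc _ hT, zero_comp]
  · intro l
    obtain ⟨h, hh⟩ := h₁.exists_eq (l ∘ₗ Linear.rightComp k X T.mor₁)
    -- Extending `h` along `T.mor₁` is obstructed by a map out of `T.obj₃⟦-1⟧`, which duality at
    -- that object shows to be zero.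
    obtain ⟨w, hw, hex⟩ : ∃ w : T.obj₃⟦(-1 : ℤ)⟧ ⟶ T.obj₁, w ≫ T.mor₁ = 0 ∧
        ∀ h : T.obj₁ ⟶ S, w ≫ h = 0 → ∃ h' : T.obj₂ ⟶ S, h = T.mor₁ ≫ h' :=
      ⟨T.invRotate.mor₁, comp_distTriang_mor_zero₁₂ _ (inv_rot_of_distTriang _ hT),
        fun h hh => T.invRotate.yoneda_exact₂ (inv_rot_of_distTriang _ hT) h hh⟩
    obtain ⟨h', rfl⟩ := hex h (h₃'.eq_zero fun x => by
      rw [← Category.assoc, hh]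
      simp [hw])
    replace hh (x : X ⟶ T.obj₁) : t (x ≫ T.mor₁ ≫ h') = l (x ≫ T.mor₁) := hh x
    obtain ⟨m, hm⟩ := exists_dual_comp_eq (Linear.rightComp k X T.mor₂)
        (l - pairing t T.obj₂ h') (by
      intro x hx
      obtain ⟨x, rfl⟩ := T.coyoneda_exact₂ hT x hx
      simp [hh])
    obtain ⟨q, hq⟩ := h₃.exists_eq m
    refine ⟨h' + T.mor₂ ≫ q, fun x => ?_⟩
    have := hm x
    rw [Linear.rightComp_apply, ← hq] at this
    rw [Preadditive.comp_add, map_add, ← Category.assoc x T.mor₂, this]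
    simp

end Triangulated

section FullyFaithful

variable {k : Type*} [Field k] {C D : Type*} [Category C] [Preadditive C] [Linear k C]
  [Category D] [Preadditive D] [Linear k D] (F : C ⥤ D) [F.Full] [F.Faithful] [F.Additive]
  [F.Linear k]

/-- The functional on `Hom(F X, F S)` induced by a functional on `Hom(X, S)` when `F` is fully
faithful. -/
def mapTrace {X S : C} (t : HomDual k X S) : HomDual k (F.obj X) (F.obj S) :=
  t ∘ₗ (LinearEquiv.ofBijective (F.mapLinearMap k (X := X) (Y := S))
    ((Functor.FullyFaithful.ofFullyFaithful F).map_bijective X S)).symm.toLinearMap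

lemma mapTrace_map {X S : C} (t : HomDual k X S) (f : X ⟶ S) :
    mapTrace F t (F.map f) = t f :=
  congrArg t (LinearEquiv.symm_apply_apply (LinearEquiv.ofBijective _ _) f)

lemma IsDualAt.map {X S Y : C} {t : HomDual k X S} (ht : IsDualAt t Y) :
    IsDualAt (mapTrace F t) (F.obj Y) := by
  apply isDualAt_of
  · intro h hh
    obtain ⟨h, rfl⟩ := F.map_surjective h
    suffices h = 0 by rw [this, Functor.map_zero]
    refine ht.eq_zero fun x => ?_
    rw [← mapTrace_map F t, Functor.map_comp]
    exact hh _
  · intro l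
    obtain ⟨h, hh⟩ := ht.exists_eq (l ∘ₗ F.mapLinearMap k)
    refine ⟨F.map h, fun x => ?_⟩
    obtain ⟨x, rfl⟩ := F.map_surjective x
    rw [← Functor.map_comp, mapTrace_map]
    exact hh x

end FullyFaithful

section Shift

variable {k : Type*} [Field k] {C : Type*} [Category C] [Preadditive C] [Linear k C]
  [HasShift C ℤ] [∀ n : ℤ, (shiftFunctor C n).Additive] [∀ n : ℤ, (shiftFunctor C n).Linear k]

/-- A functional `t` induces a functional on the shifted morphism space. -/
abbrev shiftTrace {X S : C} (t : HomDual k X S) (n : ℤ) : HomDual k (X⟦n⟧) (S⟦n⟧) :=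
  mapTrace (shiftFunctor C n) t

lemma shiftTrace_map {X S : C} (t : HomDual k X S) (n : ℤ) (f : X ⟶ S) :
    shiftTrace t n (f⟦n⟧') = t f :=
  mapTrace_map _ t f

lemma IsDualAt.shift {X S Y : C} {t : HomDual k X S} {n : ℤ} (ht : IsDualAt t (Y⟦-n⟧)) :
    IsDualAt (shiftTrace t n) Y :=
  (ht.map (shiftFunctor C n)).of_retract (.ofIso ((shiftEquiv C n).counitIso.app Y).symm)

lemma HasDual.shift {P : ObjectProperty C} [P.IsStableUnderShift ℤ] {X : C} (h : HasDual k P X)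
    (n : ℤ) : HasDual k P (X⟦n⟧) := by
  obtain ⟨S, hS, t, ht⟩ := h
  exact ⟨_, P.le_shift n _ hS, shiftTrace t n, fun Y hY => (ht _ (P.le_shift _ _ hY)).shift⟩

end Shift

open ZeroObject

section Cone

variable {k : Type*} [Field k] {C : Type*} [Category C] [Preadditive C] [Linear k C]
  [HasZeroObject C] [HasShift C ℤ] [∀ n : ℤ, (shiftFunctor C n).Additive]
  [∀ n : ℤ, (shiftFunctor C n).Linear k] [Pretriangulated C]

/-- Representability of `Hom(X, -)^*` is stable under cones. -/
lemma HasDual.cone {P : ObjectProperty C} [P.IsTriangulated] {T : Triangle C}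
    (hT : T ∈ distTriang C) (h₁ : HasDual k P T.obj₁) (h₂ : HasDual k P T.obj₂) :
    HasDual k P T.obj₃ := by
  obtain ⟨S₁, hS₁, t₁, ht₁⟩ := h₁
  obtain ⟨S₂, hS₂, t₂, ht₂⟩ := h₂
  -- `a` is the map `T.mor₁` induces on representing objects; its cone will represent the dual of
  -- `Hom(T.obj₃, -)`.
  obtain ⟨a, ha⟩ := (ht₂ S₁ hS₁).exists_eq (t₁ ∘ₗ Linear.leftComp k S₁ T.mor₁)
  replace ha (b : T.obj₂ ⟶ S₁) : t₂ (b ≫ a) = t₁ (T.mor₁ ≫ b) := ha b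
  obtain ⟨S₃, hS₃, v, d, hS⟩ := P.distinguished_cocone_triangle a hS₁ hS₂
  have hs₁ (Y : C) (hY : P Y) : IsDualAt (shiftTrace t₁ (1 : ℤ)) Y :=
    (ht₁ _ (P.le_shift _ _ hY)).shift
  have hs₂ (Y : C) (hY : P Y) : IsDualAt (shiftTrace t₂ (1 : ℤ)) Y :=
    (ht₂ _ (P.le_shift _ _ hY)).shift
  have ha' (b : T.obj₂⟦(1 : ℤ)⟧ ⟶ S₁⟦(1 : ℤ)⟧) :
      shiftTrace t₂ 1 (b ≫ a⟦1⟧') = shiftTrace t₁ 1 (T.mor₁⟦1⟧' ≫ b) := by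
    obtain ⟨b, rfl⟩ := (shiftFunctor C (1 : ℤ)).map_surjective b
    rw [← Functor.map_comp, ← Functor.map_comp, shiftTrace_map, shiftTrace_map, ha]
  -- `t₃` is prescribed on the maps `g ≫ v` and `T.mor₃ ≫ f` and extended arbitrarily. The
  -- prescriptions agree when `g ≫ v = T.mor₃ ≫ f`: completing to a morphism of triangles yields
  -- `b`, to which `ha` applies. The sign comes from rotating `T`.
  obtain ⟨t₃, ht₃⟩ := exists_dual_comp_eq
      ((Linear.rightComp k T.obj₃ v).coprod (-(Linear.leftComp k S₃ T.mor₃)))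
      ((t₂ ∘ₗ Linear.leftComp k S₂ T.mor₂).coprod
        (shiftTrace t₁ 1 ∘ₗ Linear.rightComp k (T.obj₁⟦(1 : ℤ)⟧) d)) (by
    rintro ⟨g, f⟩ hgf
    have hgf' : T.mor₃ ≫ f = g ≫ v := by
      rw [eq_comm, ← sub_eq_zero]
      simpa [LinearMap.coprod_apply, ← sub_eq_add_neg] using hgf
    obtain ⟨b, hb₁, hb₂⟩ : ∃ b : T.obj₂ ⟶ S₁, T.mor₂ ≫ g = b ≫ a ∧
        (-T.mor₁⟦(1 : ℤ)⟧') ≫ b⟦(1 : ℤ)⟧' = f ≫ d :=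
      complete_distinguished_triangle_morphism₁ T.rotate (Triangle.mk a v d)
        (rot_of_distTriang _ hT) hS g f hgf'
    simp only [LinearMap.coprod_apply, LinearMap.comp_apply, Linear.leftComp_apply,
      Linear.rightComp_apply]
    rw [hb₁, ← hb₂, Preadditive.neg_comp, map_neg, ← Functor.map_comp, shiftTrace_map, ha]
    simp)
  have h₁ (g : T.obj₃ ⟶ S₂) : t₃ (g ≫ v) = t₂ (T.mor₂ ≫ g) := by
    simpa using ht₃ (g, 0)
  have h₂ (f : T.obj₁⟦(1 : ℤ)⟧ ⟶ S₃) : t₃ (T.mor₃ ≫ f) = -shiftTrace t₁ 1 (f ≫ d) := by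
    have := ht₃ (0, f)
    simp only [LinearMap.coprod_apply, LinearMap.comp_apply, Linear.leftComp_apply, map_zero,
      Linear.rightComp_apply, LinearMap.neg_apply, map_neg, zero_add] at this
    rw [← this, neg_neg]
  have haw : a ≫ v = 0 := comp_distTriang_mor_zero₁₂ _ hS
  have hT₁ : T.mor₃ ≫ T.mor₁⟦1⟧' = 0 := comp_distTriang_mor_zero₃₁ _ hT
  refine ⟨S₃, hS₃, t₃, fun Y hY => isDualAt_of ?_ ?_⟩
  · intro h hh
    have h0 : h ≫ d = 0 := (hs₁ Y hY).eq_zero fun f => by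
      have := h₂ (f ≫ h)
      rw [← Category.assoc, hh, Category.assoc] at this
      rw [neg_eq_zero.1 this.symm]
    obtain ⟨h', rfl⟩ : ∃ h' : Y ⟶ S₂, h = h' ≫ v := Triangle.coyoneda_exact₃ _ hS h h0
    replace hh (x : T.obj₃ ⟶ Y) : t₂ (T.mor₂ ≫ x ≫ h') = 0 := by
      rw [← h₁]; simpa using hh x
    obtain ⟨l, hl⟩ := exists_dual_comp_eq (Linear.leftComp k Y T.mor₁) (pairing t₂ Y h') (by
      intro y hy
      obtain ⟨x, rfl⟩ := T.yoneda_exact₂ hT y hy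
      simpa using hh x)
    obtain ⟨q, hq⟩ := (ht₁ Y hY).exists_eq l
    have : h' = q ≫ a := (ht₂ Y hY).ext fun y => by
      rw [← Category.assoc, ha, ← Category.assoc, hq]
      exact (hl y).symm
    rw [this, Category.assoc, haw, comp_zero]
  · intro l
    obtain ⟨r, hr⟩ := (hs₁ Y hY).exists_eq (l ∘ₗ Linear.leftComp k Y T.mor₃)
    replace hr (x : T.obj₁⟦(1 : ℤ)⟧ ⟶ Y) : shiftTrace t₁ 1 (x ≫ r) = l (T.mor₃ ≫ x) := hr x
    have h0 : r ≫ a⟦1⟧' = 0 := (hs₂ Y hY).eq_zero fun y => by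
      rw [← Category.assoc, ha', ← Category.assoc, hr, reassoc_of% hT₁, zero_comp, map_zero]
    obtain ⟨h, hh⟩ : ∃ h : Y ⟶ S₃, r = h ≫ d := Triangle.coyoneda_exact₁ _ hS r h0
    -- Because of the sign in `h₂`, the functional of `h` is `-l` on maps factoring through
    -- `T.mor₃`, so it is the sum that descends along `T.mor₂`.
    obtain ⟨m, hm⟩ := exists_dual_comp_eq (Linear.leftComp k Y T.mor₂) (l + pairing t₃ Y h) (by
      intro x hx
      obtain ⟨f, rfl⟩ := T.yoneda_exact₃ hT x hx
      simp [h₂, ← hr, hh])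
    obtain ⟨p, hp⟩ := (ht₂ Y hY).exists_eq m
    refine ⟨p ≫ v - h, fun x => ?_⟩
    have := hm x
    rw [Linear.leftComp_apply, ← hp, Category.assoc, ← h₁, Category.assoc] at this
    rw [Preadditive.comp_sub, map_sub, this]
    simp

end Cone

/-! ### Thick subcategories cut out by conditions on shifts -/

section Thick

variable {C : Type*} [Category C] [Preadditive C]
  [HasZeroObject C] [HasShift C ℤ] [∀ n : ℤ, (shiftFunctor C n).Additive] [Pretriangulated C]

/-- The objects all of whose shifts satisfy `P`. -/
def allShifts (P : ObjectProperty C) : ObjectProperty C := fun X => ∀ n : ℤ, P (X⟦n⟧)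

/-- The objects almost all of whose shifts satisfy `P`. -/
def almostAllShifts (P : ObjectProperty C) : ObjectProperty C :=
  fun X => ∃ N : ℤ, ∀ n : ℤ, N < |n| → P (X⟦n⟧)

variable (P : ObjectProperty C) [P.IsStableUnderRetracts]

instance : (allShifts P).IsStableUnderRetracts where
  of_retract r h n := P.prop_of_retract (r.map (shiftFunctor C n)) (h n)

instance : (almostAllShifts P).IsStableUnderRetracts where
  of_retract r h := h.imp fun _ h n hn => P.prop_of_retract (r.map (shiftFunctor C n)) (h n hn)

/-- Imposing `P` on every shift makes shift-closure automatic and lets the argument for `T.obj₂` use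
all terms of the long exact sequence. -/
lemma isTriangulated_allShifts (h₀ : P 0)
    (h : ∀ T ∈ distTriang C, allShifts P T.obj₁ → allShifts P T.obj₃ → P T.obj₂) :
    (allShifts P).IsTriangulated where
  exists_zero := ⟨0, isZero_zero C, fun n => P.prop_of_iso (shiftFunctor C n).mapZeroObject.symm h₀⟩
  isStableUnderShiftBy a := ⟨fun X hX n =>
    P.prop_of_iso ((shiftFunctorAdd C a n).app X) (hX (a + n))⟩
  toIsTriangulatedClosed₂ := .mk' fun T hT h₁ h₃ n =>
    h _ (Triangle.shift_distinguished T hT n)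
      (fun m => P.prop_of_iso ((shiftFunctorAdd C n m).app T.obj₁) (h₁ (n + m)))
      (fun m => P.prop_of_iso ((shiftFunctorAdd C n m).app T.obj₃) (h₃ (n + m)))

lemma isTriangulated_almostAllShifts (h₀ : P 0)
    (h : ∀ T ∈ distTriang C, P T.obj₁ → P T.obj₃ → P T.obj₂) :
    (almostAllShifts P).IsTriangulated where
  exists_zero := ⟨0, isZero_zero C, 0, fun n _ =>
    P.prop_of_iso (shiftFunctor C n).mapZeroObject.symm h₀⟩
  isStableUnderShiftBy a := ⟨by
    rintro X ⟨N, hN⟩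
    refine ⟨N + |a|, fun n hn => P.prop_of_iso ((shiftFunctorAdd C a n).app X) (hN _ ?_)⟩
    have := abs_add_le (a + n) (-a)
    rw [abs_neg, show a + n + -a = n by ring] at this
    lia⟩
  toIsTriangulatedClosed₂ := .mk' fun T hT ⟨N₁, h₁⟩ ⟨N₃, h₃⟩ => ⟨max N₁ N₃, fun n hn =>
    h _ (Triangle.shift_distinguished T hT n) (h₁ n (by lia)) (h₃ n (by lia))⟩

end Thick

section Instances

variable {k : Type*} [Field k] {C : Type*} [Category C] [Preadditive C] [Linear k C]

/-- The objects `Y` such that `Hom(Y, S)` is identified with `Hom(X, Y)^*` by `t`. -/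
def dualAt {X S : C} (t : HomDual k X S) : ObjectProperty C := IsDualAt t

instance {X S : C} (t : HomDual k X S) : (dualAt t).IsStableUnderRetracts where
  of_retract r h := h.of_retract r

variable (k) in
/-- The objects `Y` with `Hom(X, Y)` finite-dimensional. -/
def finHomFrom (X : C) : ObjectProperty C := fun Y => Module.Finite k (X ⟶ Y)

variable (k) in
/-- The objects `X` with `Hom(X, Y)` finite-dimensional. -/
def finHomTo (Y : C) : ObjectProperty C := fun X => Module.Finite k (X ⟶ Y)

/-- The objects `Y` with `Hom(X, Y) = 0`. -/
def zeroHomFrom (X : C) : ObjectProperty C := fun Y => ∀ f : X ⟶ Y, f = 0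

/-- The objects `X` with `Hom(X, Y) = 0`. -/
def zeroHomTo (Y : C) : ObjectProperty C := fun X => ∀ f : X ⟶ Y, f = 0

instance (X : C) : (finHomFrom k X).IsStableUnderRetracts where
  of_retract {Y Y'} r h := by
    have : Module.Finite k (X ⟶ Y') := h
    refine Module.Finite.of_surjective (Linear.rightComp k X r.r) fun f => ⟨f ≫ r.i, ?_⟩
    simp

instance (Y : C) : (finHomTo k Y).IsStableUnderRetracts where
  of_retract {X X'} r h := by
    have : Module.Finite k (X' ⟶ Y) := h
    refine Module.Finite.of_surjective (Linear.leftComp k Y r.i) fun f => ⟨r.r ≫ f, ?_⟩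
    simp

instance (X : C) : (zeroHomFrom X).IsStableUnderRetracts where
  of_retract r h f := by
    rw [← Category.comp_id f, ← r.retract, reassoc_of% (h (f ≫ r.i)), zero_comp]

instance (Y : C) : (zeroHomTo Y).IsStableUnderRetracts where
  of_retract r h f := by
    rw [← Category.id_comp f, ← r.retract, Category.assoc, h (r.r ≫ f), comp_zero]

lemma finite_of_exact {V₁ V₂ V₃ : Type*} [AddCommGroup V₁] [AddCommGroup V₂] [AddCommGroup V₃]
    [Module k V₁] [Module k V₂] [Module k V₃] (f : V₁ →ₗ[k] V₂) (g : V₂ →ₗ[k] V₃)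
    (h : ∀ y, g y = 0 → ∃ x, y = f x) [Module.Finite k V₁] [Module.Finite k V₃] :
    Module.Finite k V₂ := by
  have h1 : (LinearMap.range f).FG := by
    rw [LinearMap.range_eq_map]
    exact Module.Finite.fg_top.map f
  have h2 : LinearMap.ker g ≤ LinearMap.range f := fun y hy => by
    obtain ⟨x, rfl⟩ := h y hy
    exact ⟨x, rfl⟩
  have : Module.Finite k (LinearMap.range f) := Module.Finite.of_fg h1
  have : Module.Finite k (LinearMap.ker g) :=
    Module.Finite.of_injective _ (Submodule.inclusion_injective h2)
  refine ⟨Submodule.fg_of_fg_map_of_fg_inf_ker g (IsNoetherian.noetherian _) ?_⟩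
  rw [top_inf_eq]
  exact (Module.Finite.iff_fg).1 this

variable [HasZeroObject C] [HasShift C ℤ] [∀ n : ℤ, (shiftFunctor C n).Additive]
  [Pretriangulated C]

/-- Reduces duality at all objects of a thick subcategory to duality at the shifts of a generator.
-/
lemma dualAt_isTriangulated {X S : C} (t : HomDual k X S) :
    (allShifts (dualAt t)).IsTriangulated := by
  refine isTriangulated_allShifts _ (isDualAt_of_subsingleton _
    (fun h => (isZero_zero C).eq_of_src _ _) (fun h => (isZero_zero C).eq_of_tgt _ _)) ?_
  intro T hT h₁ h₃
  exact isDualAt_obj₂ T hT ((h₁ 0).of_retract (.ofIso ((shiftFunctorZero C ℤ).app _).symm))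
    ((h₃ 0).of_retract (.ofIso ((shiftFunctorZero C ℤ).app _).symm)) (h₁ 1) (h₃ (-1))

lemma zeroHomFrom_obj₂ {X : C} (T : Triangle C) (hT : T ∈ distTriang C)
    (h₁ : zeroHomFrom X T.obj₁) (h₃ : zeroHomFrom X T.obj₃) : zeroHomFrom X T.obj₂ := by
  intro f
  obtain ⟨g, rfl⟩ := T.coyoneda_exact₂ hT f (h₃ _)
  rw [h₁ g, zero_comp]

lemma zeroHomTo_obj₂ {X : C} (T : Triangle C) (hT : T ∈ distTriang C)
    (h₁ : zeroHomTo X T.obj₁) (h₃ : zeroHomTo X T.obj₃) : zeroHomTo X T.obj₂ := by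
  intro f
  obtain ⟨g, rfl⟩ := T.yoneda_exact₂ hT f (h₁ _)
  rw [h₃ g, comp_zero]

lemma zeroHomFrom_isTriangulated (X : C) : (almostAllShifts (zeroHomFrom X)).IsTriangulated :=
  isTriangulated_almostAllShifts _ (fun _ => (isZero_zero C).eq_of_tgt _ _) zeroHomFrom_obj₂

lemma zeroHomTo_isTriangulated (X : C) : (almostAllShifts (zeroHomTo X)).IsTriangulated :=
  isTriangulated_almostAllShifts _ (fun _ => (isZero_zero C).eq_of_src _ _) zeroHomTo_obj₂

/-- An additive-category retract criterion: `X` lies in a thick subcategory containing `Y` as soon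
as the identity of `X` is a sum of endomorphisms which factor through `Y`. -/
lemma prop_of_sum_eq_id (P : ObjectProperty C) [P.IsTriangulated] [P.IsStableUnderRetracts]
    {ι : Type} [Fintype ι] {X Y : C} (hY : P Y) (p : ι → (X ⟶ Y)) (i : ι → (Y ⟶ X))
    (h : ∑ j, p j ≫ i j = 𝟙 X) : P X := by
  have : HasFiniteBiproducts C := HasFiniteBiproducts.of_hasFiniteProducts
  have hP : P (⨁ fun _ : ι => Y) :=
    P.prop_of_iso (biproduct.isoProduct _).symm (P.prop_product fun _ => hY)
  refine P.prop_of_retract ⟨biproduct.lift p, biproduct.desc i, ?_⟩ hP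
  rw [biproduct.lift_desc, h]

lemma finHomFrom_isTriangulated (X : C) : (allShifts (finHomFrom k X)).IsTriangulated := by
  refine isTriangulated_allShifts _ ?_ ?_
  · have : Subsingleton (X ⟶ 0) := ⟨(isZero_zero C).eq_of_tgt⟩
    exact inferInstanceAs (Module.Finite k (X ⟶ 0))
  · intro T hT h₁ h₃
    have h₁ := (finHomFrom k X).prop_of_iso ((shiftFunctorZero C ℤ).app _) (h₁ 0)
    have h₃ := (finHomFrom k X).prop_of_iso ((shiftFunctorZero C ℤ).app _) (h₃ 0)
    have : Module.Finite k (X ⟶ T.obj₁) := h₁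
    have : Module.Finite k (X ⟶ T.obj₃) := h₃
    exact finite_of_exact (Linear.rightComp k X T.mor₁) (Linear.rightComp k X T.mor₂)
      fun y hy => T.coyoneda_exact₂ hT y hy

lemma finHomTo_isTriangulated (X : C) : (allShifts (finHomTo k X)).IsTriangulated := by
  refine isTriangulated_allShifts _ ?_ ?_
  · have : Subsingleton ((0 : C) ⟶ X) := ⟨(isZero_zero C).eq_of_src⟩
    exact inferInstanceAs (Module.Finite k ((0 : C) ⟶ X))
  · intro T hT h₁ h₃
    have h₁ := (finHomTo k X).prop_of_iso ((shiftFunctorZero C ℤ).app _) (h₁ 0)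
    have h₃ := (finHomTo k X).prop_of_iso ((shiftFunctorZero C ℤ).app _) (h₃ 0)
    have : Module.Finite k (T.obj₁ ⟶ X) := h₁
    have : Module.Finite k (T.obj₃ ⟶ X) := h₃
    exact finite_of_exact (Linear.leftComp k X T.mor₂) (Linear.leftComp k X T.mor₁)
      fun y hy => T.yoneda_exact₂ hT y hy

end Instances

section FullSubcategory

variable {C : Type*} [Category C] [Preadditive C]
  [HasZeroObject C] [HasShift C ℤ] [∀ n : ℤ, (shiftFunctor C n).Additive] [Pretriangulated C]
  [IsTriangulated C]

/-- An object generates the thick subcategory of the ambient category that it spans. -/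
lemma isGenerator_of_triangEnvelope (X : C)
    [(ObjectProperty.singleton X).triangEnvelope.IsTriangulated]
    (hX : (ObjectProperty.singleton X).triangEnvelope X) :
    IsGenerator (⟨X, hX⟩ : (ObjectProperty.singleton X).triangEnvelope.FullSubcategory) := by
  set P := (ObjectProperty.singleton X).triangEnvelope
  let G : P.FullSubcategory := ⟨X, hX⟩
  let Q := (ObjectProperty.singleton G).triangEnvelope
  -- The image of `Q` in the ambient category should be thick, hence contain `P`. For retracts: one
  -- of an object of `P` lies in `P`, and its structure maps lift by fullness.
  have hret : (Q.map P.ι).IsStableUnderRetracts := ⟨by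
    rintro Y Y' r ⟨Z, hZ, ⟨e⟩⟩
    have hY : P Y := P.prop_of_retract (r.trans (.ofIso e.symm)) Z.2
    refine ⟨⟨Y, hY⟩, Q.prop_of_retract (Y := Z)
      ⟨ObjectProperty.homMk (r.i ≫ e.inv), ObjectProperty.homMk (e.hom ≫ r.r), ?_⟩ hZ,
      ⟨Iso.refl _⟩⟩
    ext
    simp⟩
  have hle : P ≤ Q.map P.ι := by
    rw [ObjectProperty.triangEnvelope_le_iff]
    intro Y hY
    obtain rfl : X = Y := by simpa using hY
    exact ⟨G, ObjectProperty.le_triangEnvelope _ _ (by simp), ⟨Iso.refl _⟩⟩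
  refine eq_top_iff.2 fun Y _ => ?_
  obtain ⟨Z, hZ, ⟨e⟩⟩ := hle _ Y.2
  exact Q.prop_of_iso (ObjectProperty.isoMk P e) hZ

end FullSubcategory

open DerivedCategory DerivedCategory.TStructure

/-! ### Truncation and vanishing in the derived category -/

section Derived

universe v
variable {C : Type u} [Category.{v} C] [Abelian C] [HasDerivedCategory.{w} C]

/-- Dévissage of a bounded object of the derived category along its truncations. -/
lemma prop_of_homology (P : ObjectProperty (DerivedCategory C)) [P.IsTriangulatedClosed₂]
    [P.IsClosedUnderIsomorphisms] [P.ContainsZero] (Q : ObjectProperty C)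
    [Q.IsClosedUnderSubobjects] [Q.IsClosedUnderQuotients] (b : ℤ) (m : ℕ) :
    ∀ (c : ℤ), (b + 1 - c).toNat = m →
    (∀ n, c ≤ n → n ≤ b → ∀ M, Q M → P ((singleFunctor C n).obj M)) →
    ∀ Y : DerivedCategory C, Y.IsGE c → Y.IsLE b →
      (∀ n, Q ((homologyFunctor C n).obj Y)) → P Y := by
  induction m with
  | zero =>
    intro c hc _ Y _ _ _
    exact P.prop_of_isZero (t.isZero Y b c (by lia))
  | succ m ih =>
    intro c hc h Y hY₁ hY₂ hQ
    obtain ⟨X, Y', hX, hY', f, g, δ, hT⟩ := t.exists_triangle Y c (c + 1) rfl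
    have : X.IsLE c := ⟨hX⟩
    have : Y'.IsGE (c + 1) := ⟨hY'⟩
    have : X.IsGE c := by
      refine t.isGE₂ _ (inv_rot_of_distTriang _ hT) c ?_ hY₁
      have := t.isGE_shift Y' (c + 1) (-1) (c + 2)
      exact t.isGE_of_ge (Y'⟦(-1 : ℤ)⟧) c (c + 2)
    have : Y'.IsLE b := by
      refine t.isLE₂ _ (rot_of_distTriang _ hT) b hY₂ ?_
      have := t.isLE_shift X c 1 (c - 1)
      exact t.isLE_of_le (X⟦(1 : ℤ)⟧) (c - 1) b
    -- The homology of the two truncations consists of subobjects and quotients of that of `Y`, so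
    -- `Q` is inherited.
    have hmono : Mono ((homologyFunctor C c).map f) :=
      (HomologySequence.mono_homologyMap_mor₁_iff _ hT (c - 1) c (by lia)).2
        ((isZero_of_isGE Y' (c + 1) (c - 1) (by lia)).eq_of_src _ _)
    have hepi (n : ℤ) : Epi ((homologyFunctor C n).map g) :=
      (HomologySequence.epi_homologyMap_mor₂_iff _ hT n (n + 1) rfl).2 (by
        by_cases hn : n < c + 1
        · exact (isZero_of_isGE Y' (c + 1) n hn).eq_of_src _ _
        · exact (isZero_of_isLE X c (n + 1) (by lia)).eq_of_tgt _ _)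
    refine P.ext_of_isTriangulatedClosed₂ _ hT ?_ ?_
    · obtain ⟨M, ⟨e⟩⟩ := exists_iso_singleFunctor_obj_of_isGE_of_isLE X c
      refine P.prop_of_iso e.symm (h c le_rfl (by lia) M ?_)
      let e' : M ≅ (homologyFunctor C c).obj X :=
        ((singleFunctorCompHomologyFunctorIso C c).app M).symm ≪≫
          (homologyFunctor C c).mapIso e.symm
      exact Q.prop_of_mono (e'.hom ≫ (homologyFunctor C c).map f) (hQ c)
    · exact ih (c + 1) (by lia) (fun n hn hn' => h n (by lia) hn') Y' inferInstance inferInstance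
        fun n => Q.prop_of_epi ((homologyFunctor C n).map g) (hQ n)

instance : (t : Triangulated.TStructure (DerivedCategory C)).bounded.IsStableUnderRetracts where
  of_retract := by
    rintro X Y r ⟨⟨a, ha⟩, ⟨b, hb⟩⟩
    refine ⟨⟨a, (isGE_iff _ _).2 fun i hi => ?_⟩, ⟨b, (isLE_iff _ _).2 fun i hi => ?_⟩⟩
    · exact .of_mono (r.map (homologyFunctor C i)).i ((isGE_iff _ _).1 ha i hi)
    · exact .of_mono (r.map (homologyFunctor C i)).i ((isLE_iff _ _).1 hb i hi)

/-- The objects with degree zero homology in `Q`. -/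
def homologyIn (Q : ObjectProperty C) : ObjectProperty (DerivedCategory C) :=
  Q.inverseImage (homologyFunctor C 0)

lemma homologyIn_shift_iff (Q : ObjectProperty C) [Q.IsClosedUnderIsomorphisms]
    (Y : DerivedCategory C) (n : ℤ) :
    homologyIn Q (Y⟦n⟧) ↔ Q ((homologyFunctor C n).obj Y) :=
  Q.prop_iff_of_iso (((homologyFunctor C 0).shiftIso n 0 n (by simp)).app Y)

instance (Q : ObjectProperty C) [Q.IsStableUnderRetracts] :
    (homologyIn Q).IsStableUnderRetracts where
  of_retract r h := Q.prop_of_retract (r.map _) h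

lemma homologyIn_isTriangulated (Q : ObjectProperty C) [Q.IsSerreClass]
    [Q.IsStableUnderRetracts] : (allShifts (homologyIn Q)).IsTriangulated := by
  refine isTriangulated_allShifts _ ?_ ?_
  · exact Q.prop_of_isZero (Functor.map_isZero _ (isZero_zero _))
  · intro T hT h₁ h₃
    have h₁ := (homologyIn Q).prop_of_iso ((shiftFunctorZero _ ℤ).app _) (h₁ 0)
    have h₃ := (homologyIn Q).prop_of_iso ((shiftFunctorZero _ ℤ).app _) (h₃ 0)
    exact Q.prop_X₂_of_exact (HomologySequence.exact₂ T hT 0) h₁ h₃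

/-- Negative degrees vanish by the `t`-structure; the others are Ext groups, bounded by projective
dimension. -/
lemma hom_single_shift_eq_zero {M N : C} {m : ℕ} [HasProjectiveDimensionLT M m] (n : ℤ)
    (hn : n < 0 ∨ (m : ℤ) ≤ n)
    (f : (singleFunctor C 0).obj M ⟶ ((singleFunctor C 0).obj N)⟦n⟧) : f = 0 := by
  by_cases hn' : n < 0
  · have := t.isGE_shift ((singleFunctor C 0).obj N) 0 n (-n)
    exact t.zero f 0 (-n) (by lia)
  · obtain ⟨n, rfl⟩ := Int.eq_ofNat_of_zero_le (not_lt.1 hn')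
    have := hasExt_of_hasDerivedCategory C
    obtain ⟨x, rfl⟩ := (Abelian.Ext.homAddEquiv (X := M) (Y := N) (n := n)).surjective f
    rw [x.eq_zero_of_hasProjectiveDimensionLT m (by lia), map_zero]

lemma zeroHomTo_single {M N : C} {m : ℕ} [HasProjectiveDimensionLT M m] (a n : ℤ)
    (hn : (m : ℤ) ≤ a + n) :
    zeroHomTo (((singleFunctor C 0).obj N)⟦n⟧) ((singleFunctor C a).obj M) := by
  intro f
  have e := ((singleFunctors C).shiftIso a 0 a (by simp)).app M
  refine (shiftFunctor (DerivedCategory C) a).map_injective ?_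
  rw [← cancel_epi e.inv, ← cancel_mono ((shiftFunctorAdd (DerivedCategory C) n a).inv.app _)]
  rw [Functor.map_zero, comp_zero, zero_comp]
  exact hom_single_shift_eq_zero (m := m) (n + a) (by lia) _

/-- If all objects have projective dimension `< m`, then `Hom(Y, N[n]) = 0` for a bounded `Y` in
degrees `≥ c` and `n ≥ m - c`. -/
lemma hom_eq_zero_of_isGE {m : ℕ} (hm : ∀ M : C, HasProjectiveDimensionLT M m) {N : C}
    (Y : DerivedCategory C) (b c n : ℤ) [Y.IsGE c] [Y.IsLE b] (hn : (m : ℤ) ≤ c + n)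
    (f : Y ⟶ ((singleFunctor C 0).obj N)⟦n⟧) : f = 0 := by
  let P := zeroHomTo (((singleFunctor C 0).obj N)⟦n⟧)
  have : P.IsTriangulatedClosed₂ := .mk' zeroHomTo_obj₂
  have : P.ContainsZero := ⟨0, isZero_zero _, fun f => (isZero_zero _).eq_of_src _ _⟩
  exact prop_of_homology P ⊤ b _ c rfl
    (fun i hi _ M _ => zeroHomTo_single (m := m) i n (by lia)) Y inferInstance inferInstance
    (fun _ => trivial) f

/-- A bounded object is in degrees `≥ c` if it receives no nonzero morphism from the objects
`G[-i]` with `i < c`, for a projective generator `G` of the heart. -/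
lemma isGE_of_hom_eq_zero {G : C} [Projective G] (hG : ∀ M : C, (∀ f : G ⟶ M, f = 0) → IsZero M)
    (Y : DerivedCategory C) (a c : ℤ) (hY : Y.IsGE a)
    (h : ∀ i < c, ∀ f : (singleFunctor C 0).obj G ⟶ Y⟦i⟧, f = 0) : Y.IsGE c := by
  obtain ⟨m, hm⟩ : ∃ m : ℕ, (c - a).toNat = m := ⟨_, rfl⟩
  induction m generalizing a with
  | zero => exact t.isGE_of_ge Y c a (by lia)
  | succ m ih =>
    refine ih (a + 1) ?_ (by lia)
    obtain ⟨X, Y', hX, hY', f, g, δ, hT⟩ := t.exists_triangle Y a (a + 1) rfl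
    have : X.IsLE a := ⟨hX⟩
    have : Y'.IsGE (a + 1) := ⟨hY'⟩
    have : X.IsGE a := by
      refine t.isGE₂ _ (inv_rot_of_distTriang _ hT) a ?_ hY
      have := t.isGE_shift Y' (a + 1) (-1) (a + 2)
      exact t.isGE_of_ge (Y'⟦(-1 : ℤ)⟧) a (a + 2)
    obtain ⟨M, ⟨e⟩⟩ := exists_iso_singleFunctor_obj_of_isGE_of_isLE X a
    have e' : (singleFunctor C 0).obj M ≅ X⟦a⟧ :=
      ((singleFunctors C).shiftIso a 0 a (by simp)).symm.app M ≪≫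
        (shiftFunctor _ a).mapIso e.symm
    have hM : IsZero M := hG M fun x => by
      apply (singleFunctor C 0).map_injective
      rw [← cancel_mono e'.hom, Functor.map_zero, zero_comp]
      set y := (singleFunctor C 0).map x ≫ e'.hom
      have hT' := inv_rot_of_distTriang _ (Triangle.shift_distinguished _ hT a)
      -- As `y` dies in `Y⟦a⟧`, it lifts to this object; `G` sits in degree `0`, so the lift is
      -- zero.
      have hZ : t.IsGE ((Y'⟦a⟧)⟦(-1 : ℤ)⟧) 2 := by
        have := t.isGE_shift Y' (a + 1) a 1
        exact t.isGE_shift (Y'⟦a⟧) 1 (-1) 2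
      obtain ⟨z, hz⟩ := Triangle.coyoneda_exact₂ _ hT' y (h a (by lia) _)
      have hz0 : z = 0 := t.zero_of_isLE_of_isGE z 0 2 (by lia) inferInstance hZ
      rw [hz, hz0]
      exact zero_comp
    have hX0 : IsZero X := (Functor.map_isZero (singleFunctor C a) hM).of_iso e
    have : IsIso g := (Triangle.isZero₁_iff_isIso₂ _ hT).1 hX0
    exact t.isGE_of_iso (asIso g).symm (a + 1)

end Derived

/-! ### Finitely generated modules and the dual of `A` -/

section Modules

variable {R : Type u} [Ring R]

variable (R) in
/-- The finitely generated modules. -/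
def isFGModule : ObjectProperty (ModuleCat.{u} R) := fun M => Module.Finite R M

instance : (isFGModule R).IsClosedUnderQuotients where
  prop_of_epi {M N} f _ h := by
    have : Module.Finite R M := h
    exact Module.Finite.of_surjective f.hom ((ModuleCat.epi_iff_surjective f).1 inferInstance)

variable [IsNoetherianRing R]

instance : (isFGModule R).IsClosedUnderSubobjects where
  prop_of_mono {M N} f _ h := by
    have : Module.Finite R N := h
    exact Module.Finite.of_injective f.hom ((ModuleCat.mono_iff_injective f).1 inferInstance)

instance : (isFGModule R).IsStableUnderRetracts where
  of_retract r h := (isFGModule R).prop_of_mono r.i h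

instance : (isFGModule R).IsSerreClass where
  exists_zero := ⟨ModuleCat.of R PUnit.{u + 1}, ModuleCat.isZero_of_subsingleton _,
    inferInstanceAs (Module.Finite R PUnit.{u + 1})⟩
  prop_X₂_of_shortExact {S} hS h₁ h₃ := by
    have : Module.Finite R S.X₁ := h₁
    have : Module.Finite R S.X₃ := h₃
    have hr : (LinearMap.range S.f.hom).FG := by
      rw [LinearMap.range_eq_map]
      exact Module.Finite.fg_top.map _
    refine ⟨Submodule.fg_of_fg_map_of_fg_inf_ker S.g.hom (IsNoetherian.noetherian _) ?_⟩
    rw [top_inf_eq, ← hS.exact.moduleCat_range_eq_ker]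
    exact hr

variable [HasDerivedCategory.{w} (ModuleCat.{u} R)]

/-- A property of objects of the derived category which is stable under cones and holds for
finitely generated projective modules holds for all finitely generated modules of finite
projective dimension. -/
lemma prop_single_of_hasProjectiveDimensionLT (V : DerivedCategory (ModuleCat.{u} R) → Prop)
    (hV : ∀ T ∈ distTriang (DerivedCategory (ModuleCat.{u} R)), V T.obj₁ → V T.obj₂ → V T.obj₃)
    (hproj : ∀ M : ModuleCat.{u} R, isFGModule R M → Projective M →
      V ((singleFunctor _ 0).obj M)) (n : ℕ) :
    ∀ M : ModuleCat.{u} R, isFGModule R M → HasProjectiveDimensionLT M (n + 1) →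
      V ((singleFunctor _ 0).obj M) := by
  induction n with
  | zero => exact fun M h h' => hproj M h (projective_iff_hasProjectiveDimensionLT_one.2 h')
  | succ n ih =>
    intro M hM h'
    have : Module.Finite R M := hM
    -- The syzygy of a finite free cover is finitely generated, as `R` is Noetherian, and its
    -- projective dimension bound drops by one.
    obtain ⟨m, f, hf⟩ := Module.Finite.exists_fin' R M
    let F := ModuleCat.of R (Fin m → R)
    have hF : isFGModule R F := inferInstanceAs (Module.Finite R (Fin m → R))
    have hF' : Projective F := inferInstance
    let g : F ⟶ M := ModuleCat.ofHom f
    have : Epi g := (ModuleCat.epi_iff_surjective g).2 hf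
    let S := ShortComplex.mk (kernel.ι g) g (kernel.condition g)
    have hS : S.ShortExact := { exact := ShortComplex.exact_kernel g }
    refine hV _ hS.singleTriangle_distinguished ?_ (hproj _ hF hF')
    exact ih _ ((isFGModule R).prop_of_mono (kernel.ι g) hF)
      ((hS.hasProjectiveDimensionLT_X₃_iff n hF').1 h')

end Modules

section RightModules

variable (k A : Type u) [Field k] [Ring A] [Algebra k A]

/-- The `k`-dual of `A`. -/
def DualSpace : Type u := A →ₗ[k] k

namespace DualSpace

instance : AddCommGroup (DualSpace k A) := inferInstanceAs (AddCommGroup (A →ₗ[k] k))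

instance : Module k (DualSpace k A) := inferInstanceAs (Module k (A →ₗ[k] k))

instance : FunLike (DualSpace k A) A k := inferInstanceAs (FunLike (A →ₗ[k] k) A k)

variable {k A}

@[ext]
lemma ext {f g : DualSpace k A} (h : ∀ x, f x = g x) : f = g := LinearMap.ext h

/-- The `k`-dual of `A` as a right module: `(f * a) x = f (a * x)`. -/
instance : Module Aᵐᵒᵖ (DualSpace k A) where
  smul a f := LinearMap.comp (f : A →ₗ[k] k) (LinearMap.mulLeft k a.unop)
  one_smul f := ext fun x => congrArg f (one_mul x)
  mul_smul _ _ f := ext fun _ => congrArg f (mul_assoc _ _ _)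
  smul_zero _ := rfl
  smul_add _ _ _ := rfl
  add_smul a b f := ext fun x =>
    (congrArg f (add_mul a.unop b.unop x)).trans (LinearMap.map_add f _ _)
  zero_smul f := ext fun x => (congrArg f (zero_mul x)).trans (LinearMap.map_zero f)

@[simp]
lemma op_smul_apply (a : Aᵐᵒᵖ) (f : DualSpace k A) (x : A) : (a • f) x = f (a.unop * x) := rfl

@[simp]
lemma smul_apply (c : k) (f : DualSpace k A) (x : A) : (c • f) x = c * f x := rfl

@[simp]
lemma add_apply (f g : DualSpace k A) (x : A) : (f + g) x = f x + g x := rfl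

lemma map_smul (f : DualSpace k A) (c : k) (x : A) : f (c • x) = c * f x :=
  LinearMap.map_smul f c x

instance : IsScalarTower k Aᵐᵒᵖ (DualSpace k A) where
  smul_assoc c a f := ext fun x => by simp [map_smul]

instance [Module.Finite k A] : Module.Finite Aᵐᵒᵖ (DualSpace k A) := by
  have : Module.Finite k (DualSpace k A) := inferInstanceAs (Module.Finite k (A →ₗ[k] k))
  exact Module.Finite.of_restrictScalars_finite k Aᵐᵒᵖ _

end DualSpace

/-- `A` as a right module. -/
def regular (A : Type u) [Ring A] : ModuleCat.{u} Aᵐᵒᵖ := ModuleCat.of Aᵐᵒᵖ A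

/-- The `k`-dual of `A` as a right module. -/
def dualRegular : ModuleCat.{u} Aᵐᵒᵖ := ModuleCat.of Aᵐᵒᵖ (DualSpace k A)

/-- Right multiplication identifies the opposite ring with `A` as right modules. -/
def regularEquiv (A : Type u) [Ring A] : Aᵐᵒᵖ ≃ₗ[Aᵐᵒᵖ] A where
  toFun := MulOpposite.unop
  invFun := MulOpposite.op
  map_add' _ _ := rfl
  map_smul' _ _ := rfl
  left_inv _ := rfl
  right_inv _ := rfl

instance : Module.Projective Aᵐᵒᵖ A := Module.Projective.of_equiv (regularEquiv A)

instance : Projective (regular A) := inferInstanceAs (Projective (ModuleCat.of Aᵐᵒᵖ A))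

lemma isNoetherianRing_mulOpposite [Module.Finite k A] : IsNoetherianRing Aᵐᵒᵖ :=
  IsNoetherianRing.of_finite k Aᵐᵒᵖ

section

variable {A}

/-- The linear map underlying a morphism from the right module `A`. -/
def toLin {M : ModuleCat.{u} Aᵐᵒᵖ} (f : regular A ⟶ M) : A →ₗ[Aᵐᵒᵖ] M := f.hom

lemma regular_hom_ext {M : ModuleCat.{u} Aᵐᵒᵖ} {f g : regular A ⟶ M}
    (h : ∀ a, toLin f a = toLin g a) : f = g :=
  ModuleCat.hom_ext (LinearMap.ext h)

/-- The morphism from `A` to a right module given by an element. -/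
def ofElement {M : ModuleCat.{u} Aᵐᵒᵖ} (x : M) : regular A ⟶ M :=
  ModuleCat.ofHom (X := A)
    { toFun := fun a => MulOpposite.op a • x
      map_add' := fun a b => by rw [MulOpposite.op_add, add_smul]
      map_smul' := fun a b => by simp [mul_smul] }

lemma toLin_ofElement {M : ModuleCat.{u} Aᵐᵒᵖ} (x : M) (a : A) :
    toLin (ofElement x) a = MulOpposite.op a • x := rfl

lemma ofElement_toLin {M : ModuleCat.{u} Aᵐᵒᵖ} (f : regular A ⟶ M) :
    ofElement (toLin f 1) = f := by
  refine regular_hom_ext fun a => ?_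
  rw [toLin_ofElement, ← map_smul]
  simp

lemma isZero_of_regular_hom_eq_zero (M : ModuleCat.{u} Aᵐᵒᵖ) (h : ∀ f : regular A ⟶ M, f = 0) :
    IsZero M := by
  have h' (x : M) : x = 0 := by
    have h1 := toLin_ofElement x 1
    rw [h (ofElement x)] at h1
    rw [MulOpposite.op_one, one_smul] at h1
    exact h1.symm
  have : Subsingleton M := ⟨fun x y => by rw [h' x, h' y]⟩
  exact ModuleCat.isZero_of_subsingleton M

end

/-- The linear families of morphisms from `X` to `Y` with parameters in `V`. -/
abbrev LinearHomFamily {C : Type*} [Category C] [Preadditive C] [Linear k C] (V : Type*)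
    [AddCommGroup V] [Module k V] (X Y : C) : Type _ := V →ₗ[k] (X ⟶ Y)

/-- Left multiplication by an element of `A`, as an endomorphism of the right module `A`. -/
def leftMul : LinearHomFamily k A (regular A) (regular A) where
  toFun a := ofElement (M := regular A) (show A from a)
  map_add' a b := regular_hom_ext fun x => by
    change (a + b) * x = a * x + b * x
    rw [add_mul]
  map_smul' c a := regular_hom_ext fun x => by
    change (c • a) * x = a * x * algebraMap k A c
    -- Scalars act on the target by right multiplication, so centrality of `k` in `A` is needed.
    rw [Algebra.smul_def, mul_assoc, Algebra.commutes]

lemma leftMul_toLin (f : regular A ⟶ regular A) : leftMul k A (toLin f 1) = f :=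
  ofElement_toLin f

lemma finHomFrom_regular [Module.Finite k A] : finHomFrom k (regular A) (regular A) :=
  Module.Finite.of_surjective (leftMul k A) fun f => ⟨_, leftMul_toLin k A f⟩

variable {k A} in
/-- The linear map underlying a morphism from `A` to its dual. -/
def toDual (f : regular A ⟶ dualRegular k A) : A →ₗ[Aᵐᵒᵖ] DualSpace k A := f.hom

/-- The functional `f ↦ f 1 1` on `Hom(A, A^*)`. -/
def regularTrace : HomDual k (regular A) (dualRegular k A) where
  toFun f := toDual f 1 1
  map_add' f g := rfl
  map_smul' c f := by
    change toDual f 1 (algebraMap k A c * 1) = c * _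
    rw [← Algebra.smul_def, DualSpace.map_smul]

/-- Both `Hom(A, A^*)` and `Hom(A, A)^*` are the `k`-dual of `A`. Testing `h` against left
multiplication by `a * b` recovers `h a b`. -/
lemma isDualAt_regularTrace : IsDualAt (regularTrace k A) (regular A) := by
  apply isDualAt_of
  · intro h hh
    refine regular_hom_ext fun a => DualSpace.ext fun b => ?_
    have h1 : regularTrace k A (leftMul k A (a * b) ≫ h) = toDual h (a * b * 1) 1 := rfl
    have h2 : toDual h (a * b) = MulOpposite.op b • toDual h a :=
      (toDual h).map_smul (MulOpposite.op b) a
    rw [hh, mul_one, h2, DualSpace.op_smul_apply, mul_one] at h1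
    exact h1.symm
  · intro l
    let φ : DualSpace k A := l ∘ₗ leftMul k A
    refine ⟨ofElement (M := dualRegular k A) φ, fun x => ?_⟩
    obtain ⟨a, rfl⟩ : ∃ a, leftMul k A a = x := ⟨_, leftMul_toLin k A x⟩
    change φ (a * 1 * 1) = φ a
    rw [mul_one, mul_one]

end RightModules

/-! ### Finiteness and vanishing for perfect complexes -/

section Perfect

variable {A : Type u} [Ring A] [HasDerivedCategory.{w} (ModuleCat.{u} Aᵐᵒᵖ)]

instance : (isPerfect A).IsStableUnderRetracts :=
  inferInstanceAs (ObjectProperty.triangEnvelope _).IsStableUnderRetracts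

variable (A) in
/-- The right module `A` as an object of the derived category. -/
abbrev regularD : DerivedCategory (ModuleCat.{u} Aᵐᵒᵖ) := (singleFunctor _ 0).obj (regular A)

lemma isPerfect_regularD : isPerfect A (regularD A) :=
  ObjectProperty.le_triangEnvelope _ _ ((ObjectProperty.singleton_iff _ _).2 rfl)

lemma isPerfect_le {P : ObjectProperty (DerivedCategory (ModuleCat.{u} Aᵐᵒᵖ))}
    [P.IsStableUnderRetracts] (hP : P.IsTriangulated) (h : P (regularD A)) : isPerfect A ≤ P := by
  rw [isPerfect, ObjectProperty.triangEnvelope_le_iff]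
  intro Y hY
  obtain rfl : regularD A = Y := (ObjectProperty.singleton_iff _ _).1 hY
  exact h

variable (A) in
lemma exists_isGenerator : ∃ G : Perf A, IsGenerator G := by
  have : (ObjectProperty.singleton (regularD A)).triangEnvelope.IsTriangulated :=
    inferInstanceAs (isPerfect A).IsTriangulated
  exact ⟨⟨regularD A, isPerfect_regularD⟩, isGenerator_of_triangEnvelope _ isPerfect_regularD⟩

lemma isPerfect_le_bounded : isPerfect A ≤ t.bounded :=
  isPerfect_le inferInstance ⟨⟨0, inferInstance⟩, ⟨0, inferInstance⟩⟩

/-- Finitely generated modules form a Serre class, so complexes with such homology form a thick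
subcategory containing `A`. -/
lemma finite_homology [IsNoetherianRing Aᵐᵒᵖ] {Y : DerivedCategory (ModuleCat.{u} Aᵐᵒᵖ)}
    (hY : isPerfect A Y) (n : ℤ) : isFGModule Aᵐᵒᵖ ((homologyFunctor _ n).obj Y) := by
  refine (homologyIn_shift_iff (isFGModule Aᵐᵒᵖ) Y n).1 ?_
  refine isPerfect_le (homologyIn_isTriangulated (isFGModule Aᵐᵒᵖ)) ?_ Y hY n
  intro m
  rw [homologyIn_shift_iff]
  by_cases hm : m = 0
  · subst hm
    refine (isFGModule Aᵐᵒᵖ).prop_of_iso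
      ((singleFunctorCompHomologyFunctorIso _ 0).app (regular A)).symm ?_
    exact Module.Finite.equiv (regularEquiv A)
  · apply (isFGModule Aᵐᵒᵖ).prop_of_isZero
    obtain h | h := lt_or_gt_of_ne hm
    · exact isZero_of_isGE _ 0 m h
    · exact isZero_of_isLE _ 0 m h

lemma hom_regularD_shift_eq_zero (N : ModuleCat.{u} Aᵐᵒᵖ) {n : ℤ} (hn : n ≠ 0)
    (f : regularD A ⟶ ((singleFunctor _ 0).obj N)⟦n⟧) : f = 0 :=
  hom_single_shift_eq_zero (m := 1) n (by lia) f

end Perfect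

section Shift

variable (k : Type*) [Field k] {C : Type*} [Category C] [Preadditive C] [Linear k C]
  [HasShift C ℤ] [∀ n : ℤ, (shiftFunctor C n).Additive] [∀ n : ℤ, (shiftFunctor C n).Linear k]

lemma exists_injective_hom_shift (X Y : C) (n : ℤ) :
    ∃ F : (X⟦n⟧ ⟶ Y) →ₗ[k] (X ⟶ Y⟦-n⟧), Function.Injective F := by
  refine ⟨Linear.leftComp k _ ((shiftEquiv C n).unit.app X) ∘ₗ
    Functor.mapLinearMap k (shiftFunctor C (-n)), fun f g h => ?_⟩
  refine (shiftFunctor C (-n)).map_injective ?_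
  exact (cancel_epi ((shiftEquiv C n).unit.app X)).1 h

variable {k}

lemma eq_zero_of_hom_shift {X Y : C} {n : ℤ} (h : ∀ g : X ⟶ Y⟦-n⟧, g = 0) (f : X⟦n⟧ ⟶ Y) :
    f = 0 := by
  refine (shiftFunctor C (-n)).map_injective ?_
  rw [Functor.map_zero]
  exact (cancel_epi ((shiftEquiv C n).unit.app X)).1 ((h _).trans comp_zero.symm)

lemma eq_zero_of_hom_shift' {X Y : C} {n : ℤ} (h : ∀ g : X⟦-n⟧ ⟶ Y, g = 0) (f : X ⟶ Y⟦n⟧) :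
    f = 0 := by
  refine (shiftFunctor C (-n)).map_injective ?_
  rw [Functor.map_zero]
  exact (cancel_mono ((shiftEquiv C n).unitInv.app Y)).1 ((h _).trans zero_comp.symm)

end Shift

section Vanishing

variable {A : Type u} [Ring A] [HasDerivedCategory.{w} (ModuleCat.{u} Aᵐᵒᵖ)]

/-- Dévissage first in the target, with source `A`, then in the source. -/
lemma exists_hom_shift_eq_zero {X Y : DerivedCategory (ModuleCat.{u} Aᵐᵒᵖ)} (hX : isPerfect A X)
    (hY : isPerfect A Y) : ∃ N : ℤ, ∀ n : ℤ, N < |n| → ∀ f : X ⟶ Y⟦n⟧, f = 0 := by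
  have h₁ : isPerfect A ≤ almostAllShifts (zeroHomFrom (regularD A)) :=
    isPerfect_le (zeroHomFrom_isTriangulated _)
      ⟨0, fun n hn f => hom_regularD_shift_eq_zero _ (abs_pos.1 hn) f⟩
  have h₂ : isPerfect A ≤ almostAllShifts (zeroHomTo Y) := by
    refine isPerfect_le (zeroHomTo_isTriangulated _) ?_
    obtain ⟨N, hN⟩ := h₁ Y hY
    refine ⟨N, fun n hn => eq_zero_of_hom_shift (hN (-n) (by rwa [abs_neg]))⟩
  obtain ⟨N, hN⟩ := h₂ X hX
  exact ⟨N, fun n hn => eq_zero_of_hom_shift' (hN (-n) (by rwa [abs_neg]))⟩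

end Vanishing

section Finite

variable {k A : Type u} [Field k] [Ring A] [Algebra k A] [Module.Finite k A]
  [HasDerivedCategory.{w} (ModuleCat.{u} Aᵐᵒᵖ)]

variable (k) in
lemma finite_hom {X Y : DerivedCategory (ModuleCat.{u} Aᵐᵒᵖ)} (hX : isPerfect A X)
    (hY : isPerfect A Y) : Module.Finite k (X ⟶ Y) := by
  have h₁ : isPerfect A ≤ allShifts (finHomFrom k (regularD A)) := by
    refine isPerfect_le (finHomFrom_isTriangulated _) fun n => ?_
    by_cases hn : n = 0
    · subst hn
      refine (finHomFrom k (regularD A)).prop_of_iso ((shiftFunctorZero _ ℤ).app _).symm ?_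
      have : Module.Finite k _ := finHomFrom_regular k A
      exact Module.Finite.of_surjective ((singleFunctor _ 0).mapLinearMap k)
        (singleFunctor _ 0).map_surjective
    · have : Subsingleton (regularD A ⟶ (regularD A)⟦n⟧) :=
        ⟨fun f g => (hom_regularD_shift_eq_zero _ hn f).trans
          (hom_regularD_shift_eq_zero _ hn g).symm⟩
      exact inferInstanceAs (Module.Finite k (regularD A ⟶ (regularD A)⟦n⟧))
  have h₂ : isPerfect A ≤ allShifts (finHomTo k Y) := by
    refine isPerfect_le (finHomTo_isTriangulated _) fun n => ?_
    obtain ⟨F, hF⟩ := exists_injective_hom_shift k (regularD A) Y n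
    have : Module.Finite k (regularD A ⟶ Y⟦-n⟧) := h₁ Y hY (-n)
    exact Module.Finite.of_injective F hF
  exact (finHomTo k Y).prop_of_iso ((shiftFunctorZero _ ℤ).app _) (h₂ X hX 0)

lemma finite_directSum (k : Type*) [Field k] (M : ℤ → Type*) [∀ i, AddCommGroup (M i)]
    [∀ i, Module k (M i)] [∀ i, Module.Finite k (M i)] (N : ℤ)
    (h : ∀ n, N < |n| → ∀ x : M n, x = 0) : Module.Finite k (DirectSum ℤ M) := by
  classical
  have hfg : (⨆ i ∈ Finset.Icc (-N) N, LinearMap.range (DirectSum.lof k ℤ M i)).FG :=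
    Submodule.fg_biSup _ _ fun i _ => by
      rw [LinearMap.range_eq_map]
      exact Module.Finite.fg_top.map _
  refine ⟨?_⟩
  convert hfg
  refine (eq_top_iff.2 fun x _ => ?_).symm
  induction x using DirectSum.induction_on with
  | zero => exact zero_mem _
  | add x y hx hy => exact add_mem (hx trivial) (hy trivial)
  | of i x =>
    by_cases hi : N < |i|
    · rw [h i hi x, map_zero]
      exact zero_mem _
    · rw [not_lt, abs_le] at hi
      exact Submodule.mem_iSup_of_mem i (Submodule.mem_iSup_of_mem (Finset.mem_Icc.2 hi) ⟨x, rfl⟩)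

variable (k A) in
lemma finite_hom_perf (X Y : Perf A) : Module.Finite k (X ⟶ Y) := by
  have : Module.Finite k ((isPerfect A).ι.obj X ⟶ (isPerfect A).ι.obj Y) := finite_hom k X.2 Y.2
  refine Module.Finite.of_injective
    (Functor.mapLinearMap k (isPerfect A).ι : (X ⟶ Y) →ₗ[k] (X.obj ⟶ Y.obj))
    (isPerfect A).ι.map_injective

variable (k A) in
lemma isExtFinite_perf : IsExtFinite k (Perf A) := by
  intro X Y
  obtain ⟨N, hN⟩ := exists_hom_shift_eq_zero X.2 Y.2
  have (i : ℤ) : Module.Finite k (X ⟶ Y⟦i⟧) := finite_hom_perf k A _ _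
  exact finite_directSum k (fun i => X ⟶ Y⟦i⟧) N fun n hn f => by
    ext
    rw [← cancel_mono (((isPerfect A).ι.commShiftIso n).hom.app Y)]
    exact (hN n hn _).trans zero_comp.symm

end Finite

/-! ### Representing objects for perfect complexes -/

section Power

variable {R : Type u} [Ring R] (N : ModuleCat.{u} R) (m : ℕ)

/-- The direct sum of `m` copies of a module. -/
def power : ModuleCat.{u} R := ModuleCat.of R (Fin m → N)

/-- The inclusion of a summand. -/
def powerι (j : Fin m) : N ⟶ power N m := ModuleCat.ofHom (LinearMap.single R (fun _ => N) j)

/-- The projection to a summand. -/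
def powerπ (j : Fin m) : power N m ⟶ N := ModuleCat.ofHom (LinearMap.proj j)

lemma sum_powerπ_powerι : ∑ j, powerπ N m j ≫ powerι N m j = 𝟙 (power N m) := by
  refine ModuleCat.hom_ext (LinearMap.ext fun x => ?_)
  rw [ModuleCat.hom_sum, LinearMap.sum_apply]
  exact Finset.univ_sum_single (show Fin m → N from x)

lemma powerι_powerπ (j l : Fin m) :
    powerι N m j ≫ powerπ N m l = if j = l then 𝟙 N else 0 := by
  refine ModuleCat.hom_ext (LinearMap.ext fun x => ?_)
  change (Pi.single j x : Fin m → N) l = _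
  split_ifs with h
  · subst h
    exact Pi.single_eq_same _ _
  · exact Pi.single_eq_of_ne (Ne.symm h) _

/-- A finitely generated projective right module is a direct summand of a power of `A`. -/
lemma exists_retract_power {A : Type u} [Ring A] (M : ModuleCat.{u} Aᵐᵒᵖ)
    (hM : isFGModule Aᵐᵒᵖ M) [Projective M] :
    ∃ m : ℕ, Nonempty (Retract M (power (regular A) m)) := by
  have : Module.Finite Aᵐᵒᵖ M := hM
  obtain ⟨m, f, hf⟩ := Module.Finite.exists_fin' Aᵐᵒᵖ M
  let e : (Fin m → A) ≃ₗ[Aᵐᵒᵖ] (Fin m → Aᵐᵒᵖ) :=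
    LinearEquiv.piCongrRight fun _ => (regularEquiv A).symm
  let g : power (regular A) m ⟶ M := ModuleCat.ofHom (X := Fin m → A) (f ∘ₗ e.toLinearMap)
  have : Epi g := (ModuleCat.epi_iff_surjective g).2 (hf.comp e.surjective)
  exact ⟨m, ⟨⟨Projective.factorThru (𝟙 M) g, g, Projective.factorThru_comp _ _⟩⟩⟩

end Power

section Representability

variable {k A : Type u} [Field k] [Ring A] [Algebra k A]
  [HasDerivedCategory.{w} (ModuleCat.{u} Aᵐᵒᵖ)]

variable (k A) in
/-- The `k`-dual of the right module `A`, as an object of the derived category. -/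
abbrev dualRegularD : DerivedCategory (ModuleCat.{u} Aᵐᵒᵖ) :=
  (singleFunctor _ 0).obj (dualRegular k A)

variable (k A) in
/-- The functional on `Hom(A, A^*)` in the derived category. -/
abbrev regularTraceD : HomDual k (regularD A) (dualRegularD k A) :=
  mapTrace (singleFunctor (ModuleCat.{u} Aᵐᵒᵖ) 0) (regularTrace k A)

/-- By dévissage in `Y` only the shifts of `A` matter, and at nonzero shifts both sides vanish since
`A` is projective. -/
lemma isDualAt_regularTraceD {Y : DerivedCategory (ModuleCat.{u} Aᵐᵒᵖ)} (hY : isPerfect A Y) :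
    IsDualAt (regularTraceD k A) Y := by
  have h : isPerfect A ≤ allShifts (dualAt (regularTraceD k A)) := by
    refine isPerfect_le (dualAt_isTriangulated _) fun n => ?_
    by_cases hn : n = 0
    · subst hn
      exact ((isDualAt_regularTrace k A).map (singleFunctor _ 0)).of_retract
        (.ofIso ((shiftFunctorZero _ ℤ).app _))
    · exact isDualAt_of_subsingleton _
        (eq_zero_of_hom_shift fun g => hom_regularD_shift_eq_zero _ (neg_ne_zero.2 hn) g)
        (hom_regularD_shift_eq_zero _ hn)
  exact (dualAt (regularTraceD k A)).prop_of_iso ((shiftFunctorZero _ ℤ).app _) (h Y hY 0)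

lemma isPerfect_of_projective (M : ModuleCat.{u} Aᵐᵒᵖ) (hM : isFGModule Aᵐᵒᵖ M) [Projective M] :
    isPerfect A ((singleFunctor _ 0).obj M) := by
  obtain ⟨m, ⟨r⟩⟩ := exists_retract_power M hM
  refine (isPerfect A).prop_of_retract (r.map (singleFunctor _ 0)) ?_
  refine prop_of_sum_eq_id (isPerfect A) isPerfect_regularD
    (fun j => (singleFunctor _ 0).map (powerπ (regular A) m j))
    (fun j => (singleFunctor _ 0).map (powerι (regular A) m j)) ?_
  simp only [← Functor.map_comp, ← Functor.map_sum, sum_powerπ_powerι, CategoryTheory.Functor.map_id]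

variable [Module.Finite k A] {d : ℕ}

lemma isPerfect_single [IsNoetherianRing Aᵐᵒᵖ]
    (hd : ∀ M : ModuleCat.{u} Aᵐᵒᵖ, HasProjectiveDimensionLT M (d + 1))
    (M : ModuleCat.{u} Aᵐᵒᵖ) (hM : isFGModule Aᵐᵒᵖ M) :
    isPerfect A ((singleFunctor _ 0).obj M) :=
  prop_single_of_hasProjectiveDimensionLT (isPerfect A)
    (fun T hT h₁ h₂ => (isPerfect A).ext_of_isTriangulatedClosed₃ T hT h₁ h₂)
    (fun M hM _ => isPerfect_of_projective M hM) d M hM (hd M)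

variable (k) in
lemma hasDual_of_projective [IsNoetherianRing Aᵐᵒᵖ]
    (hd : ∀ M : ModuleCat.{u} Aᵐᵒᵖ, HasProjectiveDimensionLT M (d + 1))
    (M : ModuleCat.{u} Aᵐᵒᵖ) (hM : isFGModule Aᵐᵒᵖ M) [Projective M] :
    HasDual k (isPerfect A) ((singleFunctor _ 0).obj M) := by
  obtain ⟨m, ⟨r⟩⟩ := exists_retract_power M hM
  have hpow (N : ModuleCat.{u} Aᵐᵒᵖ) : ∑ j, (singleFunctor _ 0).map (powerπ N m j) ≫
      (singleFunctor _ 0).map (powerι N m j) = 𝟙 _ := by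
    simp only [← Functor.map_comp, ← Functor.map_sum, sum_powerπ_powerι, CategoryTheory.Functor.map_id]
  have hpow' (N : ModuleCat.{u} Aᵐᵒᵖ) (j l : Fin m) : (singleFunctor _ 0).map (powerι N m j) ≫
      (singleFunctor _ 0).map (powerπ N m l) = if j = l then 𝟙 _ else 0 := by
    rw [← Functor.map_comp, powerι_powerπ]
    split_ifs <;> simp
  have hS' : isPerfect A ((singleFunctor _ 0).obj (power (dualRegular k A) m)) :=
    isPerfect_single hd _ (inferInstanceAs (Module.Finite Aᵐᵒᵖ (Fin m → DualSpace k A)))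
  refine HasDual.of_retract hS' _
    (fun Y hY => isDualAt_sum (isDualAt_regularTraceD hY) _ _ _ _ (hpow (regular A))
      (hpow (dualRegular k A)) (hpow' _) (hpow' _)) (r.map (singleFunctor _ 0)) ?_
  intro e he
  -- The representing object is a module, so by full faithfulness the idempotent comes from modules
  -- and splits there.
  obtain ⟨e, rfl⟩ := (singleFunctor _ 0).map_surjective e
  rw [← Functor.map_comp] at he
  obtain ⟨S, i, p, h₁, h₂⟩ :=
    IsIdempotentComplete.idempotents_split _ e ((singleFunctor _ 0).map_injective he)
  refine ⟨(singleFunctor _ 0).obj S, (singleFunctor _ 0).map i, (singleFunctor _ 0).map p, ?_, ?_⟩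
  · rw [← Functor.map_comp, h₁, CategoryTheory.Functor.map_id]
  · rw [← Functor.map_comp, h₂]

variable (k) in
lemma hasDual_single [IsNoetherianRing Aᵐᵒᵖ]
    (hd : ∀ M : ModuleCat.{u} Aᵐᵒᵖ, HasProjectiveDimensionLT M (d + 1))
    (n : ℤ) (M : ModuleCat.{u} Aᵐᵒᵖ) (hM : isFGModule Aᵐᵒᵖ M) :
    HasDual k (isPerfect A) ((singleFunctor _ n).obj M) := by
  have h : HasDual k (isPerfect A) ((singleFunctor _ 0).obj M) :=
    prop_single_of_hasProjectiveDimensionLT (HasDual k (isPerfect A))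
      (fun T hT h₁ h₂ => HasDual.cone hT h₁ h₂)
      (fun M hM _ => hasDual_of_projective k hd M hM) d M hM (hd M)
  exact (h.shift (-n)).of_iso (((singleFunctors _).shiftIso (-n) n 0 (by simp)).app M)

variable (k) in
lemma hasDual_of_isPerfect (hd : ∀ M : ModuleCat.{u} Aᵐᵒᵖ, HasProjectiveDimensionLT M (d + 1))
    {X : DerivedCategory (ModuleCat.{u} Aᵐᵒᵖ)} (hX : isPerfect A X) :
    HasDual k (isPerfect A) X := by
  have := isNoetherianRing_mulOpposite k A
  have : (ObjectProperty.IsClosedUnderIsomorphisms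
      (C := DerivedCategory (ModuleCat.{u} Aᵐᵒᵖ)) (HasDual k (isPerfect A))) :=
    ⟨fun e h => h.of_iso e⟩
  have : (ObjectProperty.IsTriangulatedClosed₂
      (C := DerivedCategory (ModuleCat.{u} Aᵐᵒᵖ)) (HasDual k (isPerfect A))) :=
    -- The middle term is the cone of `T.obj₃⟦-1⟧ ⟶ T.obj₁`.
    .mk' fun T hT h₁ h₃ => HasDual.cone (inv_rot_of_distTriang _ hT) (h₃.shift (-1)) h₁
  have : (ObjectProperty.ContainsZero
      (C := DerivedCategory (ModuleCat.{u} Aᵐᵒᵖ)) (HasDual k (isPerfect A))) :=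
    ⟨0, isZero_zero _, 0, (isPerfect A).prop_zero, 0, fun Y _ => isDualAt_of_subsingleton _
      (fun h => (isZero_zero _).eq_of_tgt _ _) (fun h => (isZero_zero _).eq_of_src _ _)⟩
  obtain ⟨⟨c, hc⟩, ⟨b, hb⟩⟩ := isPerfect_le_bounded X hX
  exact prop_of_homology (HasDual k (isPerfect A)) (isFGModule Aᵐᵒᵖ) b _ c rfl
    (fun n _ _ M hM => hasDual_single k hd n M hM) X hc hb (finite_homology hX)

variable (k) in
lemma exists_isSerreFunctor_perf
    (hd : ∀ M : ModuleCat.{u} Aᵐᵒᵖ, HasProjectiveDimensionLT M (d + 1)) :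
    ∃ S : Perf A ⥤ Perf A, IsSerreFunctor k S := by
  have := finite_hom_perf k A
  refine exists_isSerreFunctor k fun X => ?_
  obtain ⟨S, hS, t, ht⟩ := hasDual_of_isPerfect k hd X.2
  refine ⟨⟨S, hS⟩, trivial,
    t ∘ₗ (Functor.mapLinearMap k (isPerfect A).ι : (X ⟶ ⟨S, hS⟩) →ₗ[k] (X.obj ⟶ S)),
    fun Y _ => isDualAt_of ?_ ?_⟩
  · intro h hh
    ext
    exact (ht _ Y.2).eq_zero fun x => hh (ObjectProperty.homMk x)
  · intro l
    let l' : HomDual k X.obj Y.obj :=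
      { toFun := fun x => l (ObjectProperty.homMk x)
        map_add' := fun x y => map_add l (ObjectProperty.homMk x) (ObjectProperty.homMk y)
        map_smul' := fun c x => map_smul l c (ObjectProperty.homMk x) }
    obtain ⟨h, hh⟩ := (ht _ Y.2).exists_eq l'
    exact ⟨ObjectProperty.homMk h, fun x => hh x.hom⟩

end Representability

/-! ### The bound on the upper Serre dimension -/

section Dimension

lemma hasProjectiveDimensionLT_of_globalDimension {A : Type u} [Ring A] {d : ℕ}
    (hd : globalDimension A = (d : WithBot ℕ∞))
    (M : ModuleCat.{u} Aᵐᵒᵖ) : HasProjectiveDimensionLT M (d + 1) :=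
  (projectiveDimension_le_iff M d).1 (hd ▸ le_iSup (fun M => projectiveDimension M) M)

variable {k A : Type u} [Field k] [Ring A] [Algebra k A]
  [HasDerivedCategory.{w} (ModuleCat.{u} Aᵐᵒᵖ)] {d : ℕ}

/-- Every functional on `Hom(Y, S X)` comes from `Hom(X, Y)`, and functionals separate points. -/
lemma IsSerreFunctor.eq_zero {T : Type*} [Category T] [Preadditive T] [Linear k T] {S : T ⥤ T}
    (hS : IsSerreFunctor k S) {X Y : T} (h : ∀ f : X ⟶ Y, f = 0) (g : Y ⟶ S.obj X) : g = 0 := by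
  obtain ⟨η, -, -⟩ := hS
  rw [← Module.forall_dual_apply_eq_zero_iff k]
  intro l
  obtain ⟨f, rfl⟩ := (η X Y).surjective l
  rw [h f, map_zero, LinearMap.zero_apply]

/-- A Serre functor lowers the cohomological degrees by at most the global dimension. -/
lemma IsSerreFunctor.isGE_obj {S : Perf A ⥤ Perf A} (hS : IsSerreFunctor k S)
    (hd : ∀ M : ModuleCat.{u} Aᵐᵒᵖ, HasProjectiveDimensionLT M (d + 1)) (Y : Perf A) (c : ℤ)
    (hY : Y.obj.IsGE c) : (S.obj Y).obj.IsGE (c - d) := by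
  obtain ⟨⟨a, ha⟩, -⟩ := isPerfect_le_bounded _ (S.obj Y).2
  obtain ⟨-, ⟨b, hb⟩⟩ := isPerfect_le_bounded _ Y.2
  refine isGE_of_hom_eq_zero isZero_of_regular_hom_eq_zero _ a _ ha fun i hi => ?_
  refine eq_zero_of_hom_shift' fun g => ?_
  let Z : Perf A := ⟨(regularD A)⟦-i⟧, (isPerfect A).le_shift _ _ isPerfect_regularD⟩
  have hZ (f : Y ⟶ Z) : f = 0 := by
    ext
    -- The condition `i < c - d` is exactly `d + 1 ≤ c - i`.
    exact hom_eq_zero_of_isGE hd Y.obj b c (-i) (by push_cast; lia) f.hom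
  have : (ObjectProperty.homMk g : Z ⟶ S.obj Y) = 0 := hS.eq_zero hZ _
  exact congrArg InducedCategory.Hom.hom this

lemma le_eMinus_iterate {S : Perf A ⥤ Perf A} (hS : IsSerreFunctor k S)
    (hd : ∀ M : ModuleCat.{u} Aᵐᵒᵖ, HasProjectiveDimensionLT M (d + 1)) (G G' : Perf A) :
    ∃ c : ℤ, ∀ m : ℕ, (((c - m * d : ℤ) : ℝ) : EReal) ≤ eMinus G (S.obj^[m] G') := by
  obtain ⟨-, ⟨b, hb⟩⟩ := isPerfect_le_bounded _ G.2
  obtain ⟨⟨c, hc⟩, -⟩ := isPerfect_le_bounded _ G'.2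
  -- `G` lives in degrees `≤ b` and `Sᵐ G'` in degrees `≥ c - m * d`, so a nonzero `G ⟶ (Sᵐ G')⟦i⟧`
  -- forces `i ≥ c - b - m * d`.
  refine ⟨c - b, fun m => ?_⟩
  have hm : (S.obj^[m] G').obj.IsGE (c - m * d) := by
    induction m with
    | zero => simpa using hc
    | succ m ih =>
      rw [Function.iterate_succ_apply']
      have := hS.isGE_obj hd _ _ ih
      convert this using 1
      push_cast
      ring
  refine le_sInf ?_
  rintro _ ⟨i, hi, rfl⟩
  rw [EReal.coe_le_coe_iff, Int.cast_le]
  by_contra hlt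
  have hi : Nontrivial (G ⟶ (S.obj^[m] G')⟦i⟧) := hi
  refine not_subsingleton (G ⟶ (S.obj^[m] G')⟦i⟧) ⟨fun f g => ?_⟩
  have hge := t.isGE_shift (S.obj^[m] G').obj (c - m * d) i (c - m * d - i)
  have hzero (f : G.obj ⟶ (S.obj^[m] G').obj⟦i⟧) : f = 0 :=
    t.zero f b (c - m * d - i) (by lia)
  ext
  rw [← cancel_mono (((isPerfect A).ι.commShiftIso i).hom.app _)]
  exact (hzero _).trans (hzero _).symm

lemma limsup_neg_div_le (e : ℕ → EReal) (c : ℤ) (d : ℕ)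
    (h : ∀ m : ℕ, (((c - m * d : ℤ) : ℝ) : EReal) ≤ e m) :
    Filter.limsup (fun m : ℕ => -e m / (m : EReal)) Filter.atTop ≤ ((d : ℝ) : EReal) := by
  have hlim : Filter.Tendsto (fun m : ℕ => (((-c : ℝ) / m + d : ℝ) : EReal)) Filter.atTop
      (nhds ((d : ℝ) : EReal)) := by
    refine (continuous_coe_real_ereal.tendsto _).comp ?_
    simpa using (tendsto_const_div_atTop_nhds_zero_nat (-c : ℝ)).add_const (d : ℝ)
  rw [← hlim.limsup_eq]
  refine Filter.limsup_le_limsup ?_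
  filter_upwards [Filter.eventually_gt_atTop 0] with m hm
  have hm' : (m : ℝ) ≠ 0 := by positivity
  have h1 : -e m ≤ ((-(c - m * d : ℤ) : ℝ) : EReal) := by
    rw [EReal.coe_neg]
    exact EReal.neg_le_neg_iff.2 (h m)
  calc -e m / (m : EReal) ≤ ((-(c - m * d : ℤ) : ℝ) : EReal) / ((m : ℝ) : EReal) :=
        EReal.div_le_div_right_of_nonneg (by positivity) h1
    _ = (((-c : ℝ) / m + d : ℝ) : EReal) := by
        rw [← EReal.coe_div]
        congr 1
        push_cast
        field_simp
        ring

end Dimension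

end SerreDim

end

theorem mainTheorem12 {k : Type u} {A : Type u} [Field k] [Ring A] [Algebra k A]
    [Module.Finite k A] [HasDerivedCategory.{w} (ModuleCat.{u} Aᵐᵒᵖ)]
    (d : ℕ) (hd : SerreDim.globalDimension A = (d : WithBot ℕ∞)) :
    SerreDim.IsExtFinite k (SerreDim.Perf A) ∧
    (∃ G : SerreDim.Perf A, SerreDim.IsGenerator G) ∧
    (∃ S : SerreDim.Perf A ⥤ SerreDim.Perf A, SerreDim.IsSerreFunctor k S) ∧
    ∀ (S : SerreDim.Perf A ⥤ SerreDim.Perf A) (G G' : SerreDim.Perf A),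
      SerreDim.IsSerreFunctor k S → SerreDim.IsGenerator G → SerreDim.IsGenerator G' →
      SerreDim.upperSerreDim S G G' ≤ ((d : ℝ) : EReal) := by
  have hd' := SerreDim.hasProjectiveDimensionLT_of_globalDimension hd
  refine ⟨SerreDim.isExtFinite_perf k A, SerreDim.exists_isGenerator A,
    SerreDim.exists_isSerreFunctor_perf k hd', fun S G G' hS _ _ => ?_⟩
  obtain ⟨c, hc⟩ := SerreDim.le_eMinus_iterate hS hd' G G'
  exact SerreDim.limsup_neg_div_le _ c d hc
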